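/- A fuzzy transition system $\mathcal M=(S,A,\delta)$ consists of a finite set $S$ of states, a finite set $A$ of labels and a map $\delta:S\times A\to\mathcal P(\mathcal F(S))$, where $\mathcal F(S)$ is the set of fuzzy subsets $\mu:S\to[0,1]$. A pseudo-ultrametric on $S$ is a map $d:S\times S\to[0,1]$ with $d(x,x)=0$, $d(x,y)=d(y,x)$ and $d(x,z)\le\max(d(x,y),d(y,z))$. For $\mu,\eta\in\mathcal F(S)$ put $\hat d(\mu,\eta)=1$ if $\max_s\mu(s)\ne\max_s\eta(s)$, and otherwise let $\hat d(\mu,\eta)$ be the minimum of $\max_{s,t}\min(d(s,t),x_{st})$ over all $x_{st}\ge 0$ with $\max_t x_{st}=\mu(s)$ for all $s$ and $\max_s x_{st}=\eta(t)$ for all $t$. For $Y,Z\subseteq\mathcal F(S)$ let $\hat d(\mu,Z)=\inf_{\eta\in Z}\hat d(\mu,\eta)$ if $Z\neq\emptyset$ and $\hat d(\mu,\emptyset)=1$; let $H_d(\emptyset,\emptyset)=0$ and otherwise $H_d(Y,Z)=\max\big(\sup_{\mu\in Y}\hat d(\mu,Z),\sup_{\eta\in Z}\hat d(\eta,Y)\big)$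 (suprema over the empty set are $0$). For $\gamma\in(0,1)$ the behavioural distance $d^\gamma_f$ is the least fixed point, in the pointwise order on pseudo-ultrametrics on $S$, of $$\Delta(d)(s,t)=\gamma\cdot\max_{a\in A}H_d(\delta(s,a),\delta(t,a)).$$ Suppose that all sets $\delta(s,a)$ are finite and all membership degrees are rational, given as fractions in binary (not necessarily in lowest terms; the degree $0$ is written $0/1$), each set $\delta(s,a)$ being listed without repetition. Write $\|p/q\|$ for the total number of binary digits of $p$ and $q$, and $$\|\mathcal M\|=|S|+|A|+\sum_{s\in S,\,a\in A,\,\mu\in\delta(s,a)}\ \sum_{x:\ \mu(x)>0}\|\mu(x)\|.$$ **Theorem.** For every fixed rational $\gamma\in(0,1)$ there are a (multi-stack) Turing machine and a polynomial $p$ such that for every such $\mathcal M$ the distance $d^\gamma_f$ exists and is rational-valued and the machine, started on the description of $\mathcal M$, halts after at most $p(\|\mathcal M\|)$ steps and outputs the exact values $d^\gamma_f(s,t)$, $s,t\in S$, each as a fraction of natural numbers in binary. -/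

import Mathlib

namespace FuzzyTransition

/-- A fuzzy transition system with finite sets `S` of states and `A` of labels. Fuzzy subsets of `S`
are functions `S → ℝ` with values in `[0,1]`. -/
structure FTS (S A : Type) [Finite S] [Finite A] where
  /-- the fuzzy transition function -/
  δ : S → A → Set (S → ℝ)
  degree_mem : ∀ s a, ∀ μ ∈ δ s a, ∀ x, μ x ∈ Set.Icc (0 : ℝ) 1

/-- `[0,1]`-valued pseudo-ultrametrics. -/
structure IsPseudoUltrametric {X : Type} (d : X → X → ℝ) : Prop where
  mem_Icc : ∀ x y, d x y ∈ Set.Icc (0 : ℝ) 1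
  self : ∀ x, d x x = 0
  symm : ∀ x y, d x y = d y x
  ultra : ∀ x y z, d x z ≤ max (d x y) (d y z)

open scoped Classical in
/-- The lifting of `d` to fuzzy sets. Suprema over a finite index set are maxima, and the
supremum of the empty family is `0`. -/
noncomputable def lift {S : Type} (d : S → S → ℝ) (μ η : S → ℝ) : ℝ :=
  if (⨆ s, μ s) ≠ ⨆ s, η s then 1
  else sInf {v : ℝ | ∃ x : S → S → ℝ,
    (∀ s, ⨆ t, x s t = μ s) ∧ (∀ t, ⨆ s, x s t = η t) ∧ (∀ s t, 0 ≤ x s t) ∧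
      v = ⨆ p : S × S, min (d p.1 p.2) (x p.1 p.2)}

open scoped Classical in
/-- The distance from a point to a set, equal to `1` if the set is empty. -/
noncomputable def distToSet {X : Type} (d : X → X → ℝ) (x : X) (Y : Set X) : ℝ :=
  if Y.Nonempty then ⨅ y : Y, d x y else 1

open scoped Classical in
/-- The Hausdorff distance induced by a `[0,1]`-valued distance. -/
noncomputable def hausdorff {X : Type} (d : X → X → ℝ) (Y Z : Set X) : ℝ :=
  if Y = ∅ ∧ Z = ∅ then 0
  else max (⨆ y : Y, distToSet d y Z) (⨆ z : Z, distToSet d z Y)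

/-- The functional `Δ` with discount factor `γ`. -/
noncomputable def functional {S A : Type} [Finite S] [Finite A] (M : FTS S A) (γ : ℝ)
    (d : S → S → ℝ) (s t : S) : ℝ :=
  γ * ⨆ a, hausdorff (lift d) (M.δ s a) (M.δ t a)

/-- `d` is the behavioural distance of `M`: the least fixed point of `Δ` among the
pseudo-ultrametrics, which are ordered pointwise. -/
def IsBehaviouralDistance {S A : Type} [Finite S] [Finite A] (M : FTS S A) (γ : ℝ)
    (d : S → S → ℝ) : Prop :=
  IsLeast {e : S → S → ℝ | IsPseudoUltrametric e ∧ functional M γ e = e} d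

/-- A rational membership degree, given as a fraction. The fraction need not be in lowest terms, but
the degree `0` is always written `0/1`. -/
structure Degree where
  num : ℕ
  den : ℕ
  den_pos : 0 < den
  num_le_den : num ≤ den
  den_of_num_eq_zero : num = 0 → den = 1

namespace Degree

noncomputable def val (q : Degree) : ℝ := (q.num : ℝ) / (q.den : ℝ)

/-- The number of binary digits of the fraction. -/
def bits (q : Degree) : ℕ := Nat.size q.num + Nat.size q.den

theorem val_mem_Icc (q : Degree) : q.val ∈ Set.Icc (0 : ℝ) 1 := by
  refine ⟨div_nonneg (Nat.cast_nonneg _) (Nat.cast_nonneg _), ?_⟩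
  exact div_le_one_of_le₀ (by exact_mod_cast q.num_le_den) (Nat.cast_nonneg _)

end Degree

/-- A finite description of a fuzzy transition system with states `Fin n`, labels `Fin k`, finite sets
`δ(s,a)` and rational degrees: each `δ(s,a)` is listed, in any order and without repetition. -/
structure RationalFTS where
  n : ℕ
  k : ℕ
  trans : Fin n → Fin k → List (Fin n → Degree)
  nodup : ∀ s a, ((trans s a).map fun μ x => (μ x).val).Nodup

namespace RationalFTS

/-- The fuzzy transition system that is described. -/
def toFTS (M : RationalFTS) : FTS (Fin M.n) (Fin M.k) where
  δ s a := {μ | ∃ w ∈ M.trans s a, μ = fun x => (w x).val}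
  degree_mem := by
    rintro s a μ ⟨w, -, rfl⟩ x
    exact (w x).val_mem_Icc

/-- `|S| + |A| + ∑_{s, a, μ ∈ δ(s,a)} ∑_{x ∈ Supp μ} ‖μ(x)‖`. -/
def size (M : RationalFTS) : ℕ :=
  M.n + M.k + ∑ s, ∑ a, ((M.trans s a).map fun μ => ∑ x with (μ x).num ≠ 0, (μ x).bits).sum

end RationalFTS

/-- Finite sequences of natural numbers as words over the alphabet `{0, 1, #}`, where `some b` is a
binary digit and `none` is `#`: every number is written in binary, least significant digit first, and
followed by `#`. -/
def encodeNats (l : List ℕ) : List (Option Bool) :=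
  l.flatMap fun m => (Nat.bits m).map some ++ [none]

/-- The input word: `|S|`, `|A|`, and then, for all states `s` and labels `a` in order, the number of
elements of `δ(s,a)` followed by these elements, each as a vector of numerators and denominators. -/
def RationalFTS.encode (M : RationalFTS) : List (Option Bool) :=
  encodeNats (M.n :: M.k :: (List.finRange M.n).flatMap fun s => (List.finRange M.k).flatMap fun a =>
    (M.trans s a).length :: (M.trans s a).flatMap fun μ =>
      (List.finRange M.n).flatMap fun x => [(μ x).num, (μ x).den])

/-- A square matrix of fractions, row by row, as a word. -/
def encodeMatrix {n : ℕ} (num den : Fin n → Fin n → ℕ) : List (Option Bool) :=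
  encodeNats ((List.finRange n).flatMap fun s => (List.finRange n).flatMap fun t =>
    [num s t, den s t])

end FuzzyTransition

/-! The functional `Δ` can be evaluated without any minimisation over couplings. For `0 ≤ v < 1` the
lifted distance of `μ` and `η` is at most `v` exactly when both have the same height, every degree
`μ s > v` is matched by some `t` with `η t ≥ μ s` and `d s t ≤ v`, and likewise with `μ` and `η`
exchanged (`lift_le_iff`). So `Δ d` at height `γ v` depends only on the sublevel set of `d` at
height `v` (`functional_threshold`). Monotonicity of `Δ` and the explicit max-min formula used by
the algorithm both follow from this.

The least fixed point is reached exactly, after at most `|S|²` iterations from `0`. If an entry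
rises to `u` in one step, then in the step before some entry rose from below `u / γ` to at least `u
/ γ`, which exceeds `u` (`exists_change`). Tracing a late change back gives a chain of strictly
larger entries at distinct pairs of states; a change in step `|S|² + 1` would need more pairs than
there are (`exists_large_entries`, `isBehaviouralDistance_iter`).

Write `γ = a / b`. Apart from multiplication by `γ`, the algorithm only compares and selects
fractions. Hence every entry of an iterate is a power of `γ` times `0`, `1` or a membership degree,
and the number of its digits grows by a constant per iteration (`size_iterate_stepL_le`).

The rest is a polynomial-time implementation. Structured programs on four stacks compile to stack
machines with the same running time (`Run.steps`). Data are trees in Polish notation, and `PolyTime`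
is closed under composition, pairing, case distinction and folds with bounded accumulators, which
covers arithmetic, parsing and the iteration. The size of the system counts `|S|`, so the number of
states may be expanded to unary; repetition-free listing bounds the length of the input word
(`inputSize_numsOf_le`). -/

set_option linter.unusedSectionVars false

/-! ### Structured stack programs and their compilation to Turing machines. -/

namespace StackProgram

/-- The tape alphabet of all stacks. -/
abbrev Sym := Option Bool

/-- The contents of four stacks. -/
abbrev Store := Fin 4 → List Sym

/-- Structured programs on four stacks. The tests look at the top of one stack. -/
inductive Cmd
  | skip : Cmd
  | push : Fin 4 → Sym → Cmd
  | pop : Fin 4 → Cmd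
  | move : Fin 4 → Fin 4 → Cmd
  | copy : Fin 4 → Fin 4 → Cmd
  | seq : Cmd → Cmd → Cmd
  | ite : Fin 4 → (Option Sym → Bool) → Cmd → Cmd → Cmd
  | loop : Fin 4 → (Option Sym → Bool) → Cmd → Cmd

/-- `Run c s s' t`: started with the stacks `s`, the program `c` ends with the stacks `s'` after at
most `t` steps. -/
inductive Run : Cmd → Store → Store → ℕ → Prop
  | skip (s) : Run .skip s s 1
  | push (k a s) : Run (.push k a) s (Function.update s k (a :: s k)) 1
  | pop (k s) : Run (.pop k) s (Function.update s k (s k).tail) 1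
  | move (k k' s) : Run (.move k k') s
      (Function.update (Function.update s k (s k).tail) k'
        ((s k).head?.getD none :: Function.update s k (s k).tail k')) 1
  | copy (k k' s) : Run (.copy k k') s (Function.update s k' ((s k).head?.getD none :: s k')) 1
  | seq {c d s s' s'' t t'} : Run c s s' t → Run d s' s'' t' → Run (.seq c d) s s'' (t + t')
  | ite_true {k p c d s s' t} : p (s k).head? = true → Run c s s' t → Run (.ite k p c d) s s' (t + 1)
  | ite_false {k p c d s s' t} : p (s k).head? = false → Run d s s' t →
      Run (.ite k p c d) s s' (t + 1)
  | loop_done {k p c s} : p (s k).head? = false → Run (.loop k p c) s s 1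
  | loop_step {k p c s s' s'' t t'} : p (s k).head? = true → Run c s s' t →
      Run (.loop k p c) s' s'' t' → Run (.loop k p c) s s'' (t + t' + 1)
  | mono {c s s' t t'} : Run c s s' t → t ≤ t' → Run c s s' t'

/-- The labels of the machine code of a program. -/
def Lab : Cmd → Type
  | .seq c d => Lab c ⊕ Lab d
  | .ite _ _ c d => Option (Lab c ⊕ Lab d)
  | .loop _ _ c => Option (Lab c)
  | .skip | .push _ _ | .pop _ | .move _ _ | .copy _ _ => Unit

noncomputable instance Lab.fintype : (c : Cmd) → Fintype (Lab c)
  | .seq c d => by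
      have := Lab.fintype c; have := Lab.fintype d; unfold Lab; infer_instance
  | .ite _ _ c d => by
      have := Lab.fintype c; have := Lab.fintype d; unfold Lab; infer_instance
  | .loop _ _ c => by
      have := Lab.fintype c; unfold Lab; infer_instance
  | .skip | .push _ _ | .pop _ | .move _ _ | .copy _ _ => by unfold Lab; infer_instance

def entry : (c : Cmd) → Lab c
  | .seq c _ => Sum.inl (entry c)
  | .ite _ _ _ _ => (none : Option _)
  | .loop _ _ _ => (none : Option _)
  | .skip | .push _ _ | .pop _ | .move _ _ | .copy _ _ => ()

/-- Statements of stack machines with labels in `L`; the internal state is the last symbol read. -/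
abbrev MStmt (L : Type) := Turing.TM2.Stmt (fun _ : Fin 4 => Sym) L (Option Sym)

abbrev MCfg (L : Type) := Turing.TM2.Cfg (fun _ : Fin 4 => Sym) L (Option Sym)

/-- The machine code of a program, its labels being embedded into `L`, which continues at the label
`next`. -/
def code {L : Type} : (c : Cmd) → (Lab c → L) → L → Lab c → MStmt L
  | .skip, _, next, _ => .goto fun _ => next
  | .push k a, _, next, _ => .push k (fun _ => a) (.goto fun _ => next)
  | .pop k, _, next, _ => .pop k (fun v _ => v) (.goto fun _ => next)
  | .move k k', _, next, _ =>
      .pop k (fun _ o => o) (.push k' (fun v => v.getD none) (.goto fun _ => next))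
  | .copy k k', _, next, _ =>
      .peek k (fun _ o => o) (.push k' (fun v => v.getD none) (.goto fun _ => next))
  | .seq c d, e, next, l => Sum.elim (α := Lab c) (β := Lab d)
      (code c (fun l => e (Sum.inl l)) (e (Sum.inr (entry d))))
      (code d (fun l => e (Sum.inr l)) next) l
  | .ite k p c d, e, next, l => Option.elim (α := Lab c ⊕ Lab d) l
      (.peek k (fun _ o => o) (.branch p (.goto fun _ => e (some (Sum.inl (entry c))))
        (.goto fun _ => e (some (Sum.inr (entry d))))))
      (Sum.elim (code c (fun l => e (some (Sum.inl l))) next)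
        (code d (fun l => e (some (Sum.inr l))) next))
  | .loop k p c, e, next, l => Option.elim (α := Lab c) l
      (.peek k (fun _ o => o) (.branch p (.goto fun _ => e (some (entry c))) (.goto fun _ => next)))
      (code c (fun l => e (some l)) (e (none : Option (Lab c))))

/-- `n` steps of a machine. -/
def Steps {L : Type} (m : L → MStmt L) (n : ℕ) (x y : MCfg L) : Prop :=
  (flip bind (Turing.TM2.step m))^[n] (some x) = some y

theorem Steps.trans {L : Type} {m : L → MStmt L} {i j : ℕ} {x y z : MCfg L}
    (h : Steps m i x y) (h' : Steps m j y z) : Steps m (i + j) x z := by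
  unfold Steps at *
  rw [add_comm, Function.iterate_add_apply, h, h']

theorem Steps.one {L : Type} {m : L → MStmt L} {l : L} {v : Option Sym} {s : Store} :
    Steps m 1 ⟨some l, v, s⟩ (Turing.TM2.stepAux (m l) v s) := rfl

/-- The embedding `e` and the exit label `next` stay arbitrary because, in the induction, the code
of a subprogram sits inside a larger machine and continues at a label of that machine. The internal
state is arbitrary too, since every test reads its stack afresh. -/
theorem Run.steps {c : Cmd} {s s' : Store} {t : ℕ} (h : Run c s s' t) {L : Type}
    (m : L → MStmt L) (e : Lab c → L) (next : L) (hm : ∀ l, m (e l) = code c e next l)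
    (v : Option Sym) :
    ∃ n ≤ t, ∃ v', Steps m n ⟨some (e (entry c)), v, s⟩ ⟨some next, v', s'⟩ := by
  induction h generalizing next v with
  | skip | push | pop | move | copy =>
    exact ⟨1, le_rfl, _, by rw [Steps, Function.iterate_one]; simp only [flip]; simp [hm, code]; rfl⟩
  | seq _ _ ih₁ ih₂ =>
    rename_i c d _ _ _ _ _ _ _
    obtain ⟨n, hn, v', h⟩ := ih₁ (fun l => e (Sum.inl l)) (e (Sum.inr (entry d)))
      (fun l => hm (Sum.inl l)) v
    obtain ⟨n', hn', v'', h'⟩ := ih₂ (fun l => e (Sum.inr l)) next (fun l => hm (Sum.inr l)) v'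
    exact ⟨n + n', by omega, v'', h.trans h'⟩
  | ite_true hp _ ih =>
    rename_i k p c d s s' t _
    obtain ⟨n, hn, v', h⟩ := ih (fun l => e (some (Sum.inl l))) next
      (fun l => hm (some (Sum.inl l))) (s k).head?
    refine ⟨1 + n, by omega, v', Steps.trans ?_ h⟩
    have := Steps.one (m := m) (l := e (entry (.ite k p c d))) (v := v) (s := s)
    rw [hm] at this
    simpa [code, entry, hp] using this
  | ite_false hp _ ih =>
    rename_i k p c d s s' t _
    obtain ⟨n, hn, v', h⟩ := ih (fun l => e (some (Sum.inr l))) next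
      (fun l => hm (some (Sum.inr l))) (s k).head?
    refine ⟨1 + n, by omega, v', Steps.trans ?_ h⟩
    have := Steps.one (m := m) (l := e (entry (.ite k p c d))) (v := v) (s := s)
    rw [hm] at this
    simpa [code, entry, hp] using this
  | loop_done hp =>
    rename_i k p c s
    refine ⟨1, le_rfl, (s k).head?, ?_⟩
    have := Steps.one (m := m) (l := e (entry (.loop k p c))) (v := v) (s := s)
    rw [hm] at this
    simpa [code, entry, hp] using this
  | loop_step hp _ _ ih₁ ih₂ =>
    rename_i k p c s s' s'' t t' _ _
    obtain ⟨n, hn, v', h⟩ := ih₁ (fun l => e (some l)) (e (none : Option _))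
      (fun l => hm (some l)) (s k).head?
    obtain ⟨n', hn', v'', h'⟩ := ih₂ e next hm v'
    refine ⟨1 + n + n', by omega, v'', Steps.trans (Steps.trans ?_ h) h'⟩
    have := Steps.one (m := m) (l := e (entry (.loop k p c))) (v := v) (s := s)
    rw [hm] at this
    simpa [code, entry, hp] using this
  | mono _ hle ih =>
    obtain ⟨n, hn, h⟩ := ih e next hm v
    exact ⟨n, hn.trans hle, h⟩

/-- The Turing machine that runs a program; stack `0` is used for input and output. -/
noncomputable def machine (c : Cmd) : Turing.FinTM2 where
  K := Fin 4
  k₀ := 0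
  k₁ := 0
  Γ _ := Sym
  Λ := Option (Lab c)
  main := some (entry c)
  σ := Option Sym
  initialState := none
  m l := l.elim (.load (fun _ => none) .halt) (code c some none)

/-- Four stacks. -/
def st (m a b c : List Sym) : Store := ![m, a, b, c]

theorem machine_outputs {c : Cmd} {w w' : List Sym} {t : ℕ}
    (h : Run c (st w [] [] []) (st w' [] [] []) t) :
    Nonempty (Turing.TM2OutputsInTime (machine c) w (some w') (t + 1)) := by
  obtain ⟨n, hn, v, hs⟩ := h.steps (machine c).m some none (fun l => rfl) none
  -- The extra step is the halting statement, which also resets the internal state to `none` as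
  -- `Turing.haltList` requires.
  refine ⟨⟨⟨n + 1, ?_⟩, Nat.succ_le_succ hn⟩⟩
  have h1 : Turing.initList (machine c) w =
      (⟨some (some (entry c)), none, st w [] [] []⟩ : MCfg (Option (Lab c))) := by
    unfold Turing.initList
    congr 1
    funext k
    change Fin 4 at k
    fin_cases k <;> rfl
  have h2 : Turing.haltList (machine c) w' =
      (⟨none, none, st w' [] [] []⟩ : MCfg (Option (Lab c))) := by
    unfold Turing.haltList
    congr 1
    funext k
    change Fin 4 at k
    fin_cases k <;> rfl
  have h3 : Steps (machine c).m (n + 1) ⟨some (some (entry c)), none, st w [] [] []⟩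
      ⟨none, none, st w' [] [] []⟩ := hs.trans Steps.one
  rw [h1]
  exact Eq.trans h3 (congrArg some h2.symm)

infixr:60 " ;; " => Cmd.seq

/-- Each basic command adds at most one symbol. Thus a time bound is also a bound on the size of the
output, which is what makes composition of polynomial-time functions work. -/
theorem Run.sum_length_le {c : Cmd} {s s' : Store} {t : ℕ} (h : Run c s s' t) :
    ∑ k, (s' k).length ≤ ∑ k, (s k).length + t := by
  have key : ∀ (s : Store) (k : Fin 4) (l : List Sym), l.length ≤ (s k).length + 1 →
      ∑ i, (Function.update s k l i).length ≤ ∑ i, (s i).length + 1 := by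
    intro s k l hl
    rw [← Finset.sum_erase_add _ _ (Finset.mem_univ k),
      ← Finset.sum_erase_add _ (fun i => (s i).length) (Finset.mem_univ k),
      Function.update_self, add_assoc]
    refine Nat.add_le_add (Finset.sum_le_sum fun i hi => ?_) hl
    rw [Function.update_of_ne (Finset.ne_of_mem_erase hi)]
  induction h with
  | skip => omega
  | push => exact key _ _ _ (by simp)
  | pop => exact key _ _ _ (by simp; omega)
  | copy => exact key _ _ _ (by simp)
  | move k k' s =>
    refine (key _ _ _ (by simp)).trans ?_
    -- Moving from an empty stack pushes a default symbol and removes nothing; otherwise the removed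
    -- symbol pays for the pushed one.
    by_cases h : s k = []
    · have : Function.update s k (s k).tail = s := by
        rw [h, List.tail_nil, ← h, Function.update_eq_self]
      rw [this]
    · have hpos := List.length_pos_iff.2 h
      rw [← Finset.sum_erase_add _ _ (Finset.mem_univ k),
        ← Finset.sum_erase_add _ (fun i => (s i).length) (Finset.mem_univ k),
        Function.update_self, List.length_tail]
      have : ∑ i ∈ Finset.univ.erase k, (Function.update s k (s k).tail i).length =
          ∑ i ∈ Finset.univ.erase k, (s i).length :=
        Finset.sum_congr rfl fun i hi => by
          rw [Function.update_of_ne (Finset.ne_of_mem_erase hi)]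
      omega
  | seq => omega
  | ite_true => omega
  | ite_false => omega
  | loop_done => omega
  | loop_step => omega
  | mono => omega

section st

variable (m a b c x : List Sym)

@[simp] theorem st_zero : st m a b c 0 = m := rfl
@[simp] theorem st_one : st m a b c 1 = a := rfl
@[simp] theorem st_two : st m a b c 2 = b := rfl
@[simp] theorem st_three : st m a b c 3 = c := rfl
@[simp] theorem update_st_zero : Function.update (st m a b c) 0 x = st x a b c := by
  funext k; fin_cases k <;> rfl
@[simp] theorem update_st_one : Function.update (st m a b c) 1 x = st m x b c := by
  funext k; fin_cases k <;> rfl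
@[simp] theorem update_st_two : Function.update (st m a b c) 2 x = st m a x c := by
  funext k; fin_cases k <;> rfl
@[simp] theorem update_st_three : Function.update (st m a b c) 3 x = st m a b x := by
  funext k; fin_cases k <;> rfl

end st

/-! ### Trees in Polish notation as self-delimiting stack contents. -/

/-- Binary trees with Boolean leaves. -/
inductive Tree
  | leaf : Bool → Tree
  | node : Tree → Tree → Tree

/-- Polish notation. -/
def Tree.toks : Tree → List Sym
  | .leaf b => [some b]
  | .node x y => none :: (x.toks ++ y.toks)

/-- Move everything from stack `k` to stack `k'`. -/
def moveAll (k k' : Fin 4) : Cmd := .loop k Option.isSome (.move k k')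

theorem moveAll_run {k k' : Fin 4} (hk : k ≠ k') (s : Store) :
    Run (moveAll k k') s
      (Function.update (Function.update s k []) k' ((s k).reverse ++ s k'))
      (2 * (s k).length + 1) := by
  generalize h : s k = l
  induction l generalizing s with
  | nil =>
    have : Function.update (Function.update s k []) k' (List.reverse [] ++ s k') = s := by
      rw [← h, Function.update_eq_self, h]; simp
    rw [this]
    exact .loop_done (by simp [h])
  | cons x l ih =>
    have h1 := Run.move k k' s
    simp only [h, List.tail_cons, List.head?_cons, Option.getD_some,
      Function.update_of_ne hk.symm] at h1
    have h2 := ih _ (by rw [Function.update_of_ne hk, Function.update_self] :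
      Function.update (Function.update s k l) k' (x :: s k') k = l)
    refine .mono (t := 1 + (2 * l.length + 1) + 1) ?_ (by simp; omega)
    refine .loop_step (by simp [h]) h1 ?_
    convert h2 using 1
    · rfl
    funext i
    by_cases hi : i = k' <;> by_cases hi' : i = k <;> simp [hi, hi', Function.update]

/-- The loop of `grab`: the height of stack `3` is the number of trees still to be moved. -/
def grabLoop (k : Fin 4) : Cmd :=
  .loop 3 Option.isSome (.ite 0 (· == some none) (.move 0 k ;; .push 3 none) (.move 0 k ;; .pop 3))

/-- Move a tree from the main stack to stack `k`, reversing its Polish notation. -/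
def grab (k : Fin 4) : Cmd := .push 3 none ;; grabLoop k

/-- Polish notation is prefix-free, so counting pending subtrees finds the end of a tree: an inner
node raises the counter by one, a leaf lowers it by one. The statement prepends the removal of a
tree to any later run of the same loop, so that at a node the two induction hypotheses can be
chained. -/
theorem grabLoop_one_run (t : Tree) {m a b c : List Sym} {x : Sym} {s' : Store} {T : ℕ}
    (h : Run (grabLoop 1) (st m (t.toks.reverse ++ a) b c) s' T) :
    Run (grabLoop 1) (st (t.toks ++ m) a b (x :: c)) s' (T + 5 * t.toks.length) := by
  induction t generalizing m a c x T with
  | leaf v =>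
    refine .mono (.loop_step rfl (.ite_false rfl (.seq (.move 0 1 _) (.pop 3 _))) (t' := T) ?_)
      (by simp [Tree.toks]; omega)
    simpa [Tree.toks, grabLoop] using h
  | node l r ihl ihr =>
    have h' := @ihl (r.toks ++ m) (none :: a) (x :: c) none _
      (@ihr m (l.toks.reverse ++ none :: a) c x T (by simpa [Tree.toks] using h))
    refine .mono (.loop_step rfl (.ite_true rfl (.seq (.move 0 1 _) (.push 3 _ _)))
      (t' := T + 5 * r.toks.length + 5 * l.toks.length) ?_) ?_
    · simpa [Tree.toks, grabLoop] using h'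
    · simp [Tree.toks]; omega

theorem grabLoop_two_run (t : Tree) {m a b c : List Sym} {x : Sym} {s' : Store} {T : ℕ}
    (h : Run (grabLoop 2) (st m a (t.toks.reverse ++ b) c) s' T) :
    Run (grabLoop 2) (st (t.toks ++ m) a b (x :: c)) s' (T + 5 * t.toks.length) := by
  induction t generalizing m b c x T with
  | leaf v =>
    refine .mono (.loop_step rfl (.ite_false rfl (.seq (.move 0 2 _) (.pop 3 _))) (t' := T) ?_)
      (by simp [Tree.toks]; omega)
    simpa [Tree.toks, grabLoop] using h
  | node l r ihl ihr =>
    have h' := @ihl (r.toks ++ m) (none :: b) (x :: c) none _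
      (@ihr m (l.toks.reverse ++ none :: b) c x T (by simpa [Tree.toks] using h))
    refine .mono (.loop_step rfl (.ite_true rfl (.seq (.move 0 2 _) (.push 3 _ _)))
      (t' := T + 5 * r.toks.length + 5 * l.toks.length) ?_) ?_
    · simpa [Tree.toks, grabLoop] using h'
    · simp [Tree.toks]; omega

theorem grab_one_run (t : Tree) (m a b : List Sym) :
    Run (grab 1) (st (t.toks ++ m) a b []) (st m (t.toks.reverse ++ a) b [])
      (5 * t.toks.length + 2) := by
  refine .mono (.seq (.push 3 _ _) (t' := 1 + 5 * t.toks.length) ?_) (by omega)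
  simpa using grabLoop_one_run t (x := none) (.loop_done rfl)

theorem grab_two_run (t : Tree) (m a b : List Sym) :
    Run (grab 2) (st (t.toks ++ m) a b []) (st m a (t.toks.reverse ++ b) [])
      (5 * t.toks.length + 2) := by
  refine .mono (.seq (.push 3 _ _) (t' := 1 + 5 * t.toks.length) ?_) (by omega)
  simpa using grabLoop_two_run t (x := none) (.loop_done rfl)

theorem moveAll_one_zero_run (m a b : List Sym) :
    Run (moveAll 1 0) (st m a b []) (st (a.reverse ++ m) [] b []) (2 * a.length + 1) := by
  simpa using moveAll_run (by decide : (1 : Fin 4) ≠ 0) (st m a b [])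

theorem moveAll_two_zero_run (m a b : List Sym) :
    Run (moveAll 2 0) (st m a b []) (st (b.reverse ++ m) a [] []) (2 * b.length + 1) := by
  simpa using moveAll_run (by decide : (2 : Fin 4) ≠ 0) (st m a b [])

theorem moveAll_two_one_run (m a b : List Sym) :
    Run (moveAll 2 1) (st m a b []) (st m (b.reverse ++ a) [] []) (2 * b.length + 1) := by
  simpa using moveAll_run (by decide : (2 : Fin 4) ≠ 1) (st m a b [])

/-- A run that starts and ends with all stacks but the main one empty. -/
abbrev MRun (c : Cmd) (m m' : List Sym) (t : ℕ) : Prop := Run c (st m [] [] []) (st m' [] [] []) t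

/-- Exchange the two topmost trees. -/
def swapTrees : Cmd := grab 1 ;; grab 2 ;; moveAll 1 0 ;; moveAll 2 0

theorem swapTrees_run (x y : Tree) (m : List Sym) :
    MRun swapTrees (x.toks ++ (y.toks ++ m)) (y.toks ++ (x.toks ++ m))
      (7 * x.toks.length + 7 * y.toks.length + 6) := by
  refine .mono (.seq (grab_one_run x _ _ _) (.seq (grab_two_run y _ _ _)
    (.seq (moveAll_one_zero_run _ _ _) (t' := 2 * y.toks.length + 1) ?_))) ?_
  · simpa using moveAll_two_zero_run (x.toks ++ m) [] y.toks.reverse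
  · simp; omega

/-- Bring the third tree to the top. -/
def rotTrees : Cmd := grab 1 ;; grab 1 ;; grab 2 ;; moveAll 1 0 ;; moveAll 2 0

theorem rotTrees_run (x y z : Tree) (m : List Sym) :
    MRun rotTrees (x.toks ++ (y.toks ++ (z.toks ++ m))) (z.toks ++ (x.toks ++ (y.toks ++ m)))
      (7 * x.toks.length + 7 * y.toks.length + 7 * z.toks.length + 8) := by
  refine .mono (.seq (grab_one_run x _ _ _) (.seq (grab_one_run y _ _ _)
    (.seq (grab_two_run z _ _ _)
    (.seq (moveAll_one_zero_run _ _ _) (t' := 2 * z.toks.length + 1) ?_)))) ?_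
  · simpa using moveAll_two_zero_run (x.toks ++ (y.toks ++ m)) [] z.toks.reverse
  · simp; omega

/-- Remove the topmost tree. -/
def dropTree : Cmd := grab 1 ;; .loop 1 Option.isSome (.pop 1)

theorem dropTree_run (x : Tree) (m : List Sym) :
    MRun dropTree (x.toks ++ m) m (7 * x.toks.length + 3) := by
  have key : ∀ a : List Sym, Run (.loop 1 Option.isSome (.pop 1)) (st m a [] []) (st m [] [] [])
      (2 * a.length + 1) := by
    intro a
    induction a with
    | nil => exact .loop_done rfl
    | cons s a ih =>
      refine .mono (.loop_step rfl (.pop 1 _) (t' := 2 * a.length + 1) ?_) (by simp; omega)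
      simpa using ih
  refine .mono (.seq (grab_one_run x _ _ _) (key _)) ?_
  simp; omega

/-- Duplicate the topmost tree. -/
def dupTree : Cmd :=
  grab 1 ;; .loop 1 Option.isSome (.copy 1 2 ;; .move 1 0) ;; moveAll 2 1 ;; moveAll 1 0

theorem dupTree_run (x : Tree) (m : List Sym) :
    MRun dupTree (x.toks ++ m) (x.toks ++ (x.toks ++ m)) (12 * x.toks.length + 5) := by
  have key : ∀ a m b : List Sym, Run (.loop 1 Option.isSome (.copy 1 2 ;; .move 1 0))
      (st m a b []) (st (a.reverse ++ m) [] (a.reverse ++ b) []) (3 * a.length + 1) := by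
    intro a
    induction a with
    | nil => exact fun m b => .loop_done rfl
    | cons s a ih =>
      intro m b
      refine .mono (.loop_step rfl (.seq (.copy 1 2 _) (.move 1 0 _)) (t' := 3 * a.length + 1) ?_)
        (by simp; omega)
      simpa using ih (s :: m) (s :: b)
  refine .mono (.seq (grab_one_run x _ _ _) (.seq (key _ _ _)
    (.seq (moveAll_two_one_run _ _ _) (t' := 2 * x.toks.length + 1) ?_))) ?_
  · simpa using moveAll_one_zero_run (x.toks ++ m) x.toks.reverse []
  · simp; omega

/-! ### Encoding of data as trees. -/

/-- Types whose elements are represented by trees. -/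
class Enc (α : Type) where
  /-- the tree that represents an element -/
  enc : α → Tree

/-- The word that represents `a`. -/
def tk {α : Type} [Enc α] (a : α) : List Sym := (Enc.enc a).toks

/-- The length of the word that represents `a`. -/
def size {α : Type} [Enc α] (a : α) : ℕ := (tk a).length

/-- A nonempty list has the same word as the pair of its head and tail, so `cons` costs nothing, and
the top symbol distinguishes empty from nonempty lists. -/
def encList {α : Type} (e : α → Tree) : List α → Tree
  | [] => .leaf false
  | a :: l => .node (e a) (encList e l)

instance : Enc Bool := ⟨.leaf⟩
instance : Enc Unit := ⟨fun _ => .leaf false⟩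
instance {α β : Type} [Enc α] [Enc β] : Enc (α × β) := ⟨fun x => .node (Enc.enc x.1) (Enc.enc x.2)⟩
instance {α : Type} [Enc α] : Enc (List α) := ⟨encList Enc.enc⟩
instance : Enc ℕ := ⟨fun n => Enc.enc (Nat.bits n)⟩

section

variable {α β γ : Type} [Enc α] [Enc β] [Enc γ]

@[simp] theorem tk_bool (b : Bool) : tk b = [some b] := rfl
@[simp] theorem tk_prod (x : α × β) : tk x = none :: (tk x.1 ++ tk x.2) := rfl
@[simp] theorem tk_nil : tk ([] : List α) = [some false] := rfl
@[simp] theorem tk_cons (a : α) (l : List α) : tk (a :: l) = none :: (tk a ++ tk l) := rfl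
theorem tk_nat (n : ℕ) : tk n = tk (Nat.bits n) := rfl

@[simp] theorem size_bool (b : Bool) : size b = 1 := rfl
@[simp] theorem size_unit (b : Unit) : size b = 1 := rfl
@[simp] theorem size_prod (x : α × β) : size x = size x.1 + size x.2 + 1 := by simp [size]
@[simp] theorem size_nil : size ([] : List α) = 1 := rfl
@[simp] theorem size_cons (a : α) (l : List α) : size (a :: l) = size a + size l + 1 := by
  simp [size]
theorem size_nat (n : ℕ) : size n = size (Nat.bits n) := rfl

theorem length_lt_size (l : List α) : l.length < size l := by
  induction l with
  | nil => simp
  | cons a l ih => simp; omega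

theorem size_le_of_mem {a : α} {l : List α} (h : a ∈ l) : size a < size l := by
  induction l with
  | nil => simp at h
  | cons b l ih =>
    rcases List.mem_cons.1 h with rfl | h
    · simp
    · have := ih h; simp; omega

theorem size_le_of_forall {l : List α} {B : ℕ} (h : ∀ a ∈ l, size a ≤ B) :
    size l ≤ l.length * (B + 1) + 1 := by
  induction l with
  | nil => simp
  | cons a l ih =>
    have h1 := ih fun b hb => h b (List.mem_cons_of_mem _ hb)
    have h2 := h a List.mem_cons_self
    simp only [size_cons, List.length_cons, Nat.succ_mul]
    omega

end

/-! ### Polynomial-time functions and their closure properties. -/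

theorem eval_mono (p : Polynomial ℕ) {m n : ℕ} (h : m ≤ n) : p.eval m ≤ p.eval n := by
  rw [Polynomial.eval_eq_sum_range, Polynomial.eval_eq_sum_range]
  exact Finset.sum_le_sum fun i _ => Nat.mul_le_mul_left _ (Nat.pow_le_pow_left h i)

section

variable {α β γ : Type} [Enc α] [Enc β] [Enc γ]

/-- `g` is bounded by a polynomial in `μ`. -/
def PolyBd {ι : Type} (μ g : ι → ℕ) : Prop := ∃ p : Polynomial ℕ, ∀ a, g a ≤ p.eval (μ a)

section PolyBd

variable {ι : Type} {μ g h : ι → ℕ}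

theorem PolyBd.of_le (hg : PolyBd μ g) (hh : ∀ a, h a ≤ g a) : PolyBd μ h := by
  obtain ⟨p, hp⟩ := hg
  exact ⟨p, fun a => (hh a).trans (hp a)⟩

theorem PolyBd.const (n : ℕ) : PolyBd μ fun _ => n := ⟨.C n, fun _ => by simp⟩

theorem PolyBd.self : PolyBd μ fun a => μ a := ⟨.X, fun _ => by simp⟩

theorem PolyBd.add (hg : PolyBd μ g) (hh : PolyBd μ h) : PolyBd μ fun a => g a + h a := by
  obtain ⟨p, hp⟩ := hg
  obtain ⟨q, hq⟩ := hh
  exact ⟨p + q, fun a => by simpa using Nat.add_le_add (hp a) (hq a)⟩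

theorem PolyBd.mul (hg : PolyBd μ g) (hh : PolyBd μ h) : PolyBd μ fun a => g a * h a := by
  obtain ⟨p, hp⟩ := hg
  obtain ⟨q, hq⟩ := hh
  exact ⟨p * q, fun a => by simpa using Nat.mul_le_mul (hp a) (hq a)⟩

theorem PolyBd.eval (hg : PolyBd μ g) (p : Polynomial ℕ) : PolyBd μ fun a => p.eval (g a) := by
  obtain ⟨q, hq⟩ := hg
  exact ⟨p.comp q, fun a => by simpa using eval_mono p (hq a)⟩

end PolyBd

/-- `f` is computed by a program in polynomial time. -/
@[fun_prop]
def PolyTime (f : α → β) : Prop :=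
  ∃ (c : Cmd) (p : Polynomial ℕ), ∀ a m, MRun c (tk a ++ m) (tk (f a) ++ m) (p.eval (size a))

theorem PolyTime.of_run {f : α → β} (c : Cmd) {g : α → ℕ} (hg : PolyBd StackProgram.size g)
    (h : ∀ a m, MRun c (tk a ++ m) (tk (f a) ++ m) (g a)) : PolyTime f := by
  obtain ⟨p, hp⟩ := hg
  exact ⟨c, p, fun a m => (h a m).mono (hp a)⟩

theorem MRun.length_le {c : Cmd} {m m' : List Sym} {t : ℕ} (h : MRun c m m' t) :
    m'.length ≤ m.length + t := by
  simpa [Fin.sum_univ_four] using Run.sum_length_le h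

theorem PolyTime.size_bd {f : α → β} (hf : PolyTime f) : PolyBd StackProgram.size fun a => StackProgram.size (f a) := by
  obtain ⟨c, p, h⟩ := hf
  exact ⟨.X + p, fun a => by simpa [StackProgram.size] using MRun.length_le (h a [])⟩

theorem PolyTime.of_tk_eq {f g : α → β} (hg : PolyTime g) (h : ∀ a, tk (f a) = tk (g a)) :
    PolyTime f := by
  obtain ⟨c, p, hc⟩ := hg
  exact ⟨c, p, fun a m => by rw [h]; exact hc a m⟩

/-- A function that does not change the representing word. -/
theorem PolyTime.of_tk_self {f : α → β} (h : ∀ a, tk (f a) = tk a) : PolyTime f :=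
  .of_run .skip (.const 1) fun a m => by rw [h]; exact .skip _

@[fun_prop]
theorem PolyTime.id : PolyTime fun a : α => a := .of_tk_self fun _ => rfl

@[fun_prop]
theorem PolyTime.comp {g : β → γ} {f : α → β} (hg : PolyTime g) (hf : PolyTime f) :
    PolyTime fun a => g (f a) := by
  have hs := hf.size_bd
  obtain ⟨c, p, hc⟩ := hf
  obtain ⟨d, q, hd⟩ := hg
  exact .of_run (c ;; d) ((PolyBd.self.eval p).add (hs.eval q))
    fun a m => .seq (hc a m) (hd (f a) m)

theorem push_run (x : Sym) (m : List Sym) : MRun (.push 0 x) m (x :: m) 1 := by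
  simpa using Run.push 0 x (st m [] [] [])

theorem pop_run (x : Sym) (m : List Sym) : MRun (.pop 0) (x :: m) m 1 := by
  simpa using Run.pop 0 (st (x :: m) [] [] [])

theorem swap_run (a : α) (b : β) (m : List Sym) : MRun swapTrees (tk a ++ (tk b ++ m))
    (tk b ++ (tk a ++ m)) (7 * StackProgram.size a + 7 * StackProgram.size b + 6) :=
  swapTrees_run _ _ _

theorem rot_run (a : α) (b : β) (c : γ) (m : List Sym) :
    MRun rotTrees (tk a ++ (tk b ++ (tk c ++ m))) (tk c ++ (tk a ++ (tk b ++ m)))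
      (7 * StackProgram.size a + 7 * StackProgram.size b + 7 * StackProgram.size c + 8) :=
  rotTrees_run _ _ _ _

theorem drop_run (a : α) (m : List Sym) :
    MRun dropTree (tk a ++ m) m (7 * StackProgram.size a + 3) :=
  dropTree_run _ _

theorem dup_run (a : α) (m : List Sym) :
    MRun dupTree (tk a ++ m) (tk a ++ (tk a ++ m)) (12 * StackProgram.size a + 5) :=
  dupTree_run _ _

theorem pair_run (a : α) (b : β) (m : List Sym) :
    MRun (.push 0 none) (tk a ++ (tk b ++ m)) (tk (a, b) ++ m) 1 := by
  simpa using push_run none (tk a ++ (tk b ++ m))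

theorem unpair_run (a : α) (b : β) (m : List Sym) :
    MRun (.pop 0) (tk (a, b) ++ m) (tk a ++ (tk b ++ m)) 1 := by
  simpa using pop_run none (tk a ++ (tk b ++ m))

theorem uncons_run (a : α) (l : List α) (m : List Sym) :
    MRun (.pop 0) (tk (a :: l) ++ m) (tk a ++ (tk l ++ m)) 1 := by
  simpa using pop_run none (tk a ++ (tk l ++ m))

/-- Push a word. -/
def pushWord : List Sym → Cmd
  | [] => .skip
  | x :: w => pushWord w ;; .push 0 x

theorem pushWord_run (w m : List Sym) : MRun (pushWord w) m (w ++ m) (w.length + 1) := by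
  induction w with
  | nil => exact .skip _
  | cons x w ih => exact .seq ih (push_run _ _)

@[fun_prop]
theorem PolyTime.const (b : β) : PolyTime fun _ : α => b :=
  .of_run (dropTree ;; pushWord (tk b))
    (g := fun a : α => (7 * StackProgram.size a + 3) + ((tk b).length + 1))
    ((((PolyBd.const 7).mul .self).add (.const 3)).add (.const _))
    fun a m => .seq (drop_run a m) (pushWord_run (tk b) m)

@[fun_prop]
theorem PolyTime.prodMk {f : α → β} {g : α → γ} (hf : PolyTime f) (hg : PolyTime g) :
    PolyTime fun a => (f a, g a) := by
  have hs := hg.size_bd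
  obtain ⟨c, p, hc⟩ := hf
  obtain ⟨d, q, hd⟩ := hg
  -- The second component is computed first, so that the first one ends on top and a single node
  -- symbol completes the pair.
  refine .of_run (dupTree ;; d ;; swapTrees ;; c ;; .push 0 none)
    (g := fun a => (12 * StackProgram.size a + 5) + (q.eval (StackProgram.size a) +
      ((7 * StackProgram.size (g a) + 7 * StackProgram.size a + 6) +
      (p.eval (StackProgram.size a) + 1))))
    ((((PolyBd.const 12).mul .self).add (.const 5)).add ((PolyBd.self.eval q).add
      (((((PolyBd.const 7).mul hs).add ((PolyBd.const 7).mul .self)).add (.const 6)).add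
      ((PolyBd.self.eval p).add (.const 1)))))
    fun a m => ?_
  refine .seq (dup_run a m) (.seq (hd a _) (.seq (swap_run (g a) a m)
    (.seq (hc a _) (pair_run _ _ _))))

@[fun_prop]
theorem PolyTime.fst {f : α → β × γ} (hf : PolyTime f) : PolyTime fun a => (f a).1 := by
  refine PolyTime.comp (g := Prod.fst) ?_ hf
  refine .of_run (.pop 0 ;; swapTrees ;; dropTree)
    (g := fun x : β × γ => 1 + ((7 * size x + 7 * size x + 6) + (7 * size x + 3)))
    ((PolyBd.const 1).add (((((PolyBd.const 7).mul .self).add ((PolyBd.const 7).mul .self)).add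
      (.const 6)).add (((PolyBd.const 7).mul .self).add (.const 3)))) fun x m => ?_
  have h1 : size x.1 ≤ size x := by simp; omega
  have h2 : size x.2 ≤ size x := by simp; omega
  exact .seq (unpair_run _ _ _) (.seq ((swap_run x.1 x.2 m).mono (by omega))
    ((drop_run x.2 _).mono (by omega)))

@[fun_prop]
theorem PolyTime.snd {f : α → β × γ} (hf : PolyTime f) : PolyTime fun a => (f a).2 := by
  refine PolyTime.comp (g := Prod.snd) ?_ hf
  refine .of_run (.pop 0 ;; dropTree) (g := fun x : β × γ => 1 + (7 * size x + 3))
    ((PolyBd.const 1).add (((PolyBd.const 7).mul .self).add (.const 3))) fun x m => ?_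
  have h1 : size x.1 ≤ size x := by simp; omega
  exact .seq (unpair_run _ _ _) ((drop_run x.1 _).mono (by omega))

@[fun_prop]
theorem PolyTime.cond {p : α → Bool} {f g : α → β} (hp : PolyTime p) (hf : PolyTime f)
    (hg : PolyTime g) : PolyTime fun a => cond (p a) (f a) (g a) := by
  obtain ⟨c, r, hc⟩ := PolyTime.prodMk hp PolyTime.id
  obtain ⟨d, q, hd⟩ := hf
  obtain ⟨d', q', hd'⟩ := hg
  refine .of_run (c ;; .pop 0 ;; .ite 0 (· == some (some true)) (.pop 0 ;; d) (.pop 0 ;; d'))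
    (g := fun a => r.eval (StackProgram.size a) +
      (1 + ((1 + (q.eval (StackProgram.size a) + q'.eval (StackProgram.size a))) + 1)))
    ((PolyBd.self.eval r).add ((PolyBd.const 1).add (((PolyBd.const 1).add
      ((PolyBd.self.eval q).add (PolyBd.self.eval q'))).add (.const 1)))) fun a m => ?_
  refine .seq (hc a m) (.seq (pop_run _ _) ?_)
  cases h : p a
  · refine .ite_false (by simpa [Enc.enc, Tree.toks] using h) (.seq (pop_run _ _) ((hd' a m).mono ?_))
    omega
  · refine .ite_true (by simpa [Enc.enc, Tree.toks] using h) (.seq (pop_run _ _) ((hd a m).mono ?_))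
    omega

@[fun_prop]
theorem PolyTime.cons {f : α → β} {g : α → List β} (hf : PolyTime f) (hg : PolyTime g) :
    PolyTime fun a => f a :: g a :=
  PolyTime.comp (g := fun x : β × List β => x.1 :: x.2) (.of_tk_self fun _ => rfl) (hf.prodMk hg)

@[fun_prop]
theorem PolyTime.isEmpty {f : α → List β} (hf : PolyTime f) : PolyTime fun a => (f a).isEmpty := by
  refine PolyTime.comp (g := List.isEmpty) ?_ hf
  refine .of_run (.ite 0 (· == some none) (dropTree ;; .push 0 (some false))
      (dropTree ;; .push 0 (some true))) (g := fun x : List β => (7 * size x + 3 + 1) + 1)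
    (((((PolyBd.const 7).mul .self).add (.const 3)).add (.const 1)).add (.const 1)) fun l m => ?_
  cases l with
  | nil => exact .mono (.ite_false rfl (.seq (drop_run [] m) (push_run (some true) m))) le_rfl
  | cons b l =>
    exact .mono (.ite_true rfl (.seq (drop_run (b :: l) m) (push_run (some false) m))) le_rfl

@[fun_prop]
theorem PolyTime.tail {f : α → List β} (hf : PolyTime f) : PolyTime fun a => (f a).tail := by
  refine PolyTime.comp (g := List.tail) ?_ hf
  refine .of_run (.ite 0 (· == some none) (.pop 0 ;; dropTree) .skip)
    (g := fun x : List β => (1 + (7 * size x + 3)) + 1)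
    (((PolyBd.const 1).add (((PolyBd.const 7).mul .self).add (.const 3))).add (.const 1))
    fun l m => ?_
  cases l with
  | nil => exact .ite_false rfl ((Run.skip _).mono (by omega))
  | cons b l =>
    refine .ite_true rfl (.seq (uncons_run _ _ _) ((drop_run b _).mono ?_))
    simp; omega

@[fun_prop]
theorem PolyTime.headI [Inhabited β] {f : α → List β} (hf : PolyTime f) :
    PolyTime fun a => (f a).headI := by
  refine PolyTime.comp (g := List.headI) ?_ hf
  refine .of_run (.ite 0 (· == some none) (.pop 0 ;; swapTrees ;; dropTree)
      (.pop 0 ;; pushWord (tk (default : β))))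
    (g := fun x : List β => (1 + (size (default : β) + (7 * size x + 7 * size x + 6) +
      (7 * size x + 3))) + 1)
    (((PolyBd.const 1).add (((PolyBd.const _).add
      ((((PolyBd.const 7).mul .self).add ((PolyBd.const 7).mul .self)).add (.const 6))).add
      (((PolyBd.const 7).mul .self).add (.const 3)))).add (.const 1)) fun l m => ?_
  cases l with
  | nil =>
    refine .ite_false rfl (.seq (pop_run _ _) ((pushWord_run _ _).mono ?_))
    change size (default : β) + 1 ≤ _
    omega
  | cons b l =>
    refine .mono (.ite_true rfl (.seq (uncons_run _ _ _)
      (.seq (swap_run b l m) (drop_run l _)))) ?_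
    simp; omega

/-- The program for `List.foldl`, where `c` is a program for the step function. -/
def foldCmd (c : Cmd) : Cmd :=
  .loop 0 (· == some none) (.pop 0 ;; rotTrees ;; .push 0 none ;; c ;; swapTrees) ;; .pop 0

/-- Before each round the remaining list lies above the accumulator. The round exposes the head,
brings the accumulator up, pairs the two for `c`, and puts the new accumulator below the tail. The
bound `B` on the accumulators at all prefixes is indispensable: iterating a polynomial-time step can
otherwise produce exponentially long values. -/
theorem foldCmd_run {f : β → γ → β} {c : Cmd} {p : Polynomial ℕ}
    (hc : ∀ (z : β × γ) m, MRun c (tk z ++ m) (tk (f z.1 z.2) ++ m) (p.eval (size z)))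
    (l : List γ) (b : β) (B : ℕ) (hl : size l ≤ B)
    (hb : ∀ l', l' <+: l → size (l'.foldl f b) ≤ B) (m : List Sym) :
    MRun (foldCmd c) (tk l ++ (tk b ++ m)) (tk (l.foldl f b) ++ m)
      (B * (28 * B + p.eval (2 * B + 1) + 17) + 2) := by
  have key : ∀ (l : List γ) (b : β), size l ≤ B →
      (∀ l', l' <+: l → size (l'.foldl f b) ≤ B) →
      MRun (.loop 0 (· == some none) (.pop 0 ;; rotTrees ;; .push 0 none ;; c ;; swapTrees))
        (tk l ++ (tk b ++ m)) (some false :: (tk (l.foldl f b) ++ m))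
        (l.length * (28 * B + p.eval (2 * B + 1) + 17) + 1) := by
    intro l
    induction l with
    | nil => intro b _ _; exact .mono (.loop_done rfl) (by simp)
    | cons x l ih =>
      intro b hl hb
      have h1 := ih (f b x) (by simp at hl; omega) fun l' hl' => by
        simpa using hb (x :: l') (List.cons_prefix_cons.2 ⟨rfl, hl'⟩)
      have hs0 : size b ≤ B := by simpa using hb [] List.nil_prefix
      have hs1 : size (f b x) ≤ B := by
        simpa using hb [x] (List.cons_prefix_cons.2 ⟨rfl, List.nil_prefix⟩)
      have hp : p.eval (size (b, x)) ≤ p.eval (2 * B + 1) := eval_mono p (by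
        simp at hl ⊢; omega)
      refine .mono (.loop_step rfl (.seq (uncons_run _ _ _)
        (.seq (rot_run x l b m) (.seq (pair_run _ _ _) (.seq ((hc (b, x) (tk l ++ m)).mono hp)
        (swap_run (f b x) l m))))) h1) ?_
      simp only [size_cons] at hl
      simp only [List.length_cons, Nat.succ_mul]
      omega
  -- The last pop removes the leaf that represents the empty list.
  refine .mono (.seq (key l b hl hb) (pop_run _ _)) ?_
  have := Nat.mul_le_mul_right (28 * B + p.eval (2 * B + 1) + 17)
    ((length_lt_size l).le.trans hl)
  omega

theorem PolyTime.foldl {l : α → List γ} {b : α → β} {f : α → β → γ → β} (hl : PolyTime l)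
    (hb : PolyTime b) (hf : PolyTime fun z : α × β × γ => f z.1 z.2.1 z.2.2) {B : α → ℕ}
    (hB : PolyBd StackProgram.size B) (h : ∀ a l', l' <+: l a → StackProgram.size (l'.foldl (f a) (b a)) ≤ B a) :
    PolyTime fun a => (l a).foldl (f a) (b a) := by
  -- The parameter `a` is carried along in the accumulator, since the step program sees nothing
  -- else.
  have hf' : PolyTime fun z : (α × β) × γ => (z.1.1, f z.1.1 z.1.2 z.2) :=
    .prodMk (by fun_prop) (hf.comp (f := fun z : (α × β) × γ => (z.1.1, z.1.2, z.2)) (by fun_prop))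
  have hfold : ∀ a (l : List γ) (b : β),
      l.foldl (fun (x : α × β) y => (x.1, f x.1 x.2 y)) (a, b) = (a, l.foldl (f a) b) := by
    intro a l
    induction l with
    | nil => intro b; rfl
    | cons x l ih => intro b; exact ih _
  have hls := hl.size_bd
  obtain ⟨c, p, hc⟩ := hl.prodMk (PolyTime.id.prodMk hb)
  obtain ⟨d, q, hd⟩ := hf'
  have : PolyTime fun a => (a, (l a).foldl (f a) (b a)) := by
    refine .of_run (c ;; .pop 0 ;; foldCmd d) (g := fun a => p.eval (StackProgram.size a) + (1 +
        ((StackProgram.size (l a) + StackProgram.size a + B a + 1) *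
        (28 * (StackProgram.size (l a) + StackProgram.size a + B a + 1) +
          q.eval (2 * (StackProgram.size (l a) + StackProgram.size a + B a + 1) + 1) + 17) + 2)))
      ?_ fun a m => ?_
    · have h1 := ((hls.add .self).add hB).add (.const 1)
      exact (PolyBd.self.eval p).add ((PolyBd.const 1).add ((h1.mul ((((PolyBd.const 28).mul h1).add
        ((((PolyBd.const 2).mul h1).add (.const 1)).eval q)).add (.const 17))).add (.const 2)))
    · refine .seq (hc a m) (.seq (unpair_run _ _ _) ?_)
      rw [← hfold]
      refine foldCmd_run (c := d) (p := q) (f := fun (x : α × β) y => (x.1, f x.1 x.2 y))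
        hd (l a) (a, b a) _ (by omega) (fun l' hl' => ?_) m
      rw [hfold]
      have := h a l' hl'
      simp
      omega
  exact this.snd

/-- Folds whose accumulator satisfies an invariant under which it grows by a bounded amount. -/
theorem PolyTime.foldl_of_growth {l : α → List γ} {b : α → β} {f : α → β → γ → β} (hl : PolyTime l)
    (hb : PolyTime b) (hf : PolyTime fun z : α × β × γ => f z.1 z.2.1 z.2.2) {g : α → ℕ}
    (hg : PolyBd StackProgram.size g) (I : α → β → Prop) (h0 : ∀ a, I a (b a))
    (hI : ∀ a x y, I a x → y ∈ l a → I a (f a x y) ∧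
      StackProgram.size (f a x y) ≤ StackProgram.size x + g a) :
    PolyTime fun a => (l a).foldl (f a) (b a) := by
  refine hl.foldl hb hf (B := fun a => StackProgram.size (b a) + StackProgram.size (l a) * g a)
    (hb.size_bd.add (hl.size_bd.mul hg)) fun a l' hl' => ?_
  have key : ∀ (l' : List γ) (x : β), (∀ y ∈ l', y ∈ l a) → I a x →
      StackProgram.size (l'.foldl (f a) x) ≤ StackProgram.size x + l'.length * g a := by
    intro l'
    induction l' with
    | nil => intro x _ _; simp
    | cons y l' ih =>
      intro x hy hx
      have h1 := hI a x y hx (hy y List.mem_cons_self)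
      have h2 := ih (f a x y) (fun z hz => hy z (List.mem_cons_of_mem _ hz)) h1.1
      simp only [List.foldl_cons, List.length_cons, Nat.succ_mul]
      omega
  refine (key l' (b a) (fun y hy => hl'.subset hy) (h0 a)).trans ?_
  have := (hl'.length_le).trans (length_lt_size (l a)).le
  exact Nat.add_le_add_left (Nat.mul_le_mul_right _ this) _

theorem PolyTime.reverse {l : α → List β} (hl : PolyTime l) : PolyTime fun a => (l a).reverse := by
  have : PolyTime fun a => (l a).foldl (fun out x => x :: out) [] :=
    hl.foldl_of_growth (f := fun _ out x => x :: out) (by fun_prop) (by fun_prop)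
      (hl.size_bd.add (.const 1)) (fun _ _ => True) (fun _ => trivial)
      fun a x y _ hy => ⟨trivial, by have := size_le_of_mem hy; simp; omega⟩
  simpa only [List.foldl_flip_cons_eq_append', List.append_nil] using this

attribute [fun_prop] PolyTime.reverse

@[fun_prop]
theorem PolyTime.append {l l' : α → List β} (hl : PolyTime l) (hl' : PolyTime l') :
    PolyTime fun a => l a ++ l' a := by
  have : PolyTime fun a => (l a).reverse.foldl (fun out x => x :: out) (l' a) :=
    hl.reverse.foldl_of_growth (f := fun _ out x => x :: out) (by fun_prop) (by fun_prop)
      (hl.size_bd.add (.const 1)) (fun _ _ => True) (fun _ => trivial)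
      fun a x y _ hy => ⟨trivial, by have := size_le_of_mem (List.mem_reverse.1 hy); simp; omega⟩
  simpa only [List.foldl_flip_cons_eq_append', List.reverse_reverse] using this

@[fun_prop]
theorem PolyTime.map {l : α → List β} {f : α → β → γ} (hl : PolyTime l)
    (hf : PolyTime fun z : α × β => f z.1 z.2) : PolyTime fun a => (l a).map (f a) := by
  obtain ⟨p, hp⟩ := hf.size_bd
  have : PolyTime fun a => ((l a).foldl (fun out x => f a x :: out) []).reverse := by
    refine .reverse (hl.foldl_of_growth (f := fun a out x => f a x :: out) (by fun_prop)
      (.cons (hf.comp (f := fun z : α × List γ × β => (z.1, z.2.2)) (by fun_prop)) (by fun_prop))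
      (((PolyBd.self.add hl.size_bd).eval p).add (.const 1)) (fun _ _ => True) (fun _ => trivial)
      fun a x y _ hy => ⟨trivial, ?_⟩)
    have h1 := hp (a, y)
    have h2 := eval_mono p (m := StackProgram.size (a, y))
      (n := StackProgram.size a + StackProgram.size (l a)) (by
        have := size_le_of_mem hy
        simp; omega)
    simp only [size_cons]
    dsimp only at h1
    omega
  have h : ∀ a (l : List β) out, l.foldl (fun out x => f a x :: out) out =
      (l.map (f a)).reverse ++ out := by
    intro a l
    induction l with
    | nil => simp
    | cons x l ih => intro out; simp [ih]
  simpa [h] using this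

end

/-! ### Binary arithmetic in polynomial time. -/

section

variable {α : Type} [Enc α]

@[fun_prop]
theorem PolyTime.not {f : α → Bool} (hf : PolyTime f) : PolyTime fun a => !(f a) := by
  have : PolyTime fun a => bif f a then false else true := by fun_prop
  exact this.of_tk_eq fun a => by cases f a <;> rfl

@[fun_prop]
theorem PolyTime.and {f g : α → Bool} (hf : PolyTime f) (hg : PolyTime g) :
    PolyTime fun a => f a && g a := by
  have : PolyTime fun a => bif f a then g a else false := by fun_prop
  exact this.of_tk_eq fun a => by cases f a <;> rfl

@[fun_prop]
theorem PolyTime.or {f g : α → Bool} (hf : PolyTime f) (hg : PolyTime g) :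
    PolyTime fun a => f a || g a := by
  have : PolyTime fun a => bif f a then true else g a := by fun_prop
  exact this.of_tk_eq fun a => by cases f a <;> rfl

@[fun_prop]
theorem PolyTime.xor {f g : α → Bool} (hf : PolyTime f) (hg : PolyTime g) :
    PolyTime fun a => Bool.xor (f a) (g a) := by
  have : PolyTime fun a => bif f a then !(g a) else g a := by fun_prop
  exact this.of_tk_eq fun a => by cases f a <;> cases g a <;> rfl

@[fun_prop]
theorem PolyTime.bits {f : α → ℕ} (hf : PolyTime f) : PolyTime fun a => (f a).bits :=
  PolyTime.comp (g := Nat.bits) (.of_tk_self fun _ => rfl) hf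

@[fun_prop]
theorem PolyTime.bodd {f : α → ℕ} (hf : PolyTime f) : PolyTime fun a => (f a).bodd := by
  simpa only [Nat.bodd_eq_bits_head] using hf.bits.headI

@[fun_prop]
theorem PolyTime.div2 {f : α → ℕ} (hf : PolyTime f) : PolyTime fun a => (f a).div2 := by
  have h : PolyTime fun a => (f a).bits.tail := by fun_prop
  obtain ⟨c, p, hc⟩ := h
  refine ⟨c, p, fun a m => ?_⟩
  rw [tk_nat, Nat.div2_bits_eq_tail]
  exact hc a m

/-- Digit lists carry no leading zeros, so prefixing a digit `0` to the digits of `0` must leave the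
list empty. -/
theorem bits_bit (b : Bool) (n : ℕ) : (Nat.bit b n).bits = cond (!b && n.bits.isEmpty) [] (b :: n.bits) := by
  by_cases hn : n = 0
  · subst hn
    cases b <;> simp
  · have : n.bits.isEmpty = false := by
      rw [Bool.eq_false_iff]
      intro h
      rw [List.isEmpty_iff] at h
      have := Nat.size_eq_bits_len n
      rw [h] at this
      exact hn (Nat.size_eq_zero.1 this.symm)
    rw [Nat.bits_append_bit _ _ (fun h => (hn h).elim)]
    simp [this]

@[fun_prop]
theorem PolyTime.bit {f : α → Bool} {g : α → ℕ} (hf : PolyTime f) (hg : PolyTime g) :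
    PolyTime fun a => Nat.bit (f a) (g a) := by
  have h : PolyTime fun a => bif !(f a) && (g a).bits.isEmpty then [] else f a :: (g a).bits := by
    fun_prop
  obtain ⟨c, p, hc⟩ := h
  refine ⟨c, p, fun a m => ?_⟩
  rw [tk_nat, bits_bit]
  exact hc a m

theorem size_bits (n : ℕ) : size n = 2 * Nat.size n + 1 := by
  rw [size_nat, ← Nat.size_eq_bits_len]
  induction n.bits with
  | nil => rfl
  | cons b l ih => simp [ih]; omega

theorem size_bit_le (b : Bool) (n : ℕ) : size (Nat.bit b n) ≤ size n + 2 := by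
  rw [size_nat, size_nat, bits_bit]
  cases h : (!b && n.bits.isEmpty) <;> simp
  omega

theorem size_div2_le (n : ℕ) : size n.div2 ≤ size n := by
  rw [size_nat, size_nat, Nat.div2_bits_eq_tail]
  cases n.bits <;> simp
  omega

/-- The number with the given binary digits, the most significant one first. -/
def ofDigits (l : List Bool) : ℕ := l.foldl (fun n b => Nat.bit b n) 0

@[fun_prop]
theorem PolyTime.ofDigits {l : α → List Bool} (hl : PolyTime l) :
    PolyTime fun a => ofDigits (l a) :=
  hl.foldl_of_growth (f := fun _ n b => Nat.bit b n) (by fun_prop) (by fun_prop) (.const 2)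
    (fun _ _ => True) (fun _ => trivial) fun _ x y _ _ => ⟨trivial, size_bit_le y x⟩

theorem foldl_bit (l : List Bool) (n : ℕ) :
    l.foldl (fun n b => Nat.bit b n) n = n * 2 ^ l.length + ofDigits l := by
  induction l generalizing n with
  | nil => simp [ofDigits]
  | cons b l ih =>
    rw [ofDigits, List.foldl_cons, List.foldl_cons, ih, ih (Nat.bit b 0), Nat.bit_val, Nat.bit_val,
      List.length_cons, pow_succ]
    ring

theorem ofDigits_cons (b : Bool) (l : List Bool) :
    ofDigits (b :: l) = b.toNat * 2 ^ l.length + ofDigits l := by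
  rw [ofDigits, List.foldl_cons, foldl_bit, Nat.bit_val]
  simp

theorem ofDigits_lt (l : List Bool) : ofDigits l < 2 ^ l.length := by
  induction l with
  | nil => simp [ofDigits]
  | cons b l ih =>
    rw [ofDigits_cons, List.length_cons, pow_succ]
    cases b <;> simp <;> omega

theorem ofDigits_bits_reverse (n : ℕ) : ofDigits n.bits.reverse = n := by
  rw [ofDigits, List.foldl_reverse]
  induction n using Nat.binaryRec' with
  | zero => rfl
  | bit b n h ih => rw [Nat.bits_append_bit _ _ h, List.foldr_cons, ih]

theorem lt_two_pow_bits (n : ℕ) : n < 2 ^ n.bits.length := by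
  conv_lhs => rw [← ofDigits_bits_reverse n]
  simpa using ofDigits_lt n.bits.reverse

/-- One step of binary addition: the rest of the summands, the carry and the digits found so far. -/
def addStep (s : ℕ × ℕ × Bool × List Bool) : ℕ × ℕ × Bool × List Bool :=
  (s.1.div2, s.2.1.div2,
    (s.1.bodd && s.2.1.bodd) || (s.2.2.1 && Bool.xor s.1.bodd s.2.1.bodd),
    Bool.xor s.2.2.1 (Bool.xor s.1.bodd s.2.1.bodd) :: s.2.2.2)

def addBits (x y : ℕ) : ℕ :=
  ofDigits ((false :: (x.bits ++ y.bits)).foldl (fun s _ => addStep s) (x, y, false, [])).2.2.2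

/-- School addition preserves the digits found so far plus `2 ^ (their number)` times the sum of
both rests and the carry. The loop is long enough for `2 ^ (number of digits)` to exceed `x + y`,
which forces the rests and the carry to be `0`. -/
theorem addBits_eq (x y : ℕ) : addBits x y = x + y := by
  have step : ∀ s : ℕ × ℕ × Bool × List Bool,
      ofDigits (addStep s).2.2.2 + 2 ^ (addStep s).2.2.2.length *
        ((addStep s).1 + (addStep s).2.1 + (addStep s).2.2.1.toNat) =
      ofDigits s.2.2.2 + 2 ^ s.2.2.2.length * (s.1 + s.2.1 + s.2.2.1.toNat) := by
    rintro ⟨x, y, c, l⟩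
    have hx := Nat.bodd_add_div2 x
    have hy := Nat.bodd_add_div2 y
    simp only [addStep, ofDigits_cons, List.length_cons, pow_succ]
    generalize x.div2 = x' at *
    generalize y.div2 = y' at *
    generalize x.bodd = bx at *
    generalize y.bodd = by' at *
    subst hx hy
    cases bx <;> cases by' <;> cases c <;> simp <;> ring
  have fold : ∀ (l : List Bool) (s : ℕ × ℕ × Bool × List Bool),
      (l.foldl (fun s _ => addStep s) s).2.2.2.length = l.length + s.2.2.2.length ∧
      (fun t : ℕ × ℕ × Bool × List Bool =>
        ofDigits t.2.2.2 + 2 ^ t.2.2.2.length * (t.1 + t.2.1 + t.2.2.1.toNat))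
          (l.foldl (fun s _ => addStep s) s) =
      ofDigits s.2.2.2 + 2 ^ s.2.2.2.length * (s.1 + s.2.1 + s.2.2.1.toNat) := by
    intro l
    induction l with
    | nil => intro s; simp
    | cons b l ih =>
      intro s
      refine ⟨?_, ?_⟩
      · rw [List.foldl_cons, (ih _).1]
        simp [addStep]
        omega
      · rw [List.foldl_cons, (ih _).2, step]
  obtain ⟨h1, h2⟩ := fold (false :: (x.bits ++ y.bits)) (x, y, false, [])
  unfold addBits
  generalize (false :: (x.bits ++ y.bits)).foldl (fun s _ => addStep s) (x, y, false, []) = t at *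
  have hx := lt_two_pow_bits x
  have hy := lt_two_pow_bits y
  have hlt : x + y < 2 ^ t.2.2.2.length := by
    rw [h1]
    simp only [List.length_cons, List.length_append, List.length_nil, pow_succ, pow_add]
    nlinarith [Nat.one_le_two_pow (n := x.bits.length), Nat.one_le_two_pow (n := y.bits.length)]
  simp only [ofDigits, List.foldl_nil, List.length_nil, pow_zero, one_mul, Bool.toNat_false,
    add_zero, zero_add] at h2
  rcases Nat.eq_zero_or_pos (t.1 + t.2.1 + t.2.2.1.toNat) with h | h
  · rw [h] at h2
    simpa [ofDigits] using h2
  · have := Nat.le_mul_of_pos_right (2 ^ t.2.2.2.length) h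
    omega

@[fun_prop]
theorem PolyTime.add {f g : α → ℕ} (hf : PolyTime f) (hg : PolyTime g) :
    PolyTime fun a => f a + g a := by
  have hstep : PolyTime addStep := by unfold addStep; fun_prop
  have : PolyTime fun a => addBits (f a) (g a) := by
    refine .ofDigits (PolyTime.snd (.snd (.snd (PolyTime.foldl_of_growth
      (l := fun a => false :: ((f a).bits ++ (g a).bits)) (f := fun _ s _ => addStep s)
      (by fun_prop) (by fun_prop) (hstep.comp (by fun_prop)) (.const 2) (fun _ _ => True)
      (fun _ => trivial) fun _ x y _ _ => ⟨trivial, ?_⟩))))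
    have h1 := size_div2_le x.1
    have h2 := size_div2_le x.2.1
    simp [addStep]
    omega
  simpa only [addBits_eq] using this

/-- Binary multiplication. -/
def mulBits (x y : ℕ) : ℕ := x.bits.reverse.foldl (fun n b => n + n + bif b then y else 0) 0

/-- This is Horner's scheme. Stated for any digit list, it also evaluates the accumulator at every
prefix, which supplies the size bound for `PolyTime.mul`. -/
theorem foldl_mulBits (l : List Bool) (y : ℕ) :
    l.foldl (fun n b => n + n + bif b then y else 0) 0 = ofDigits l * y := by
  have : ∀ (l : List Bool) n, l.foldl (fun n b => n + n + bif b then y else 0) (n * y) =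
      l.foldl (fun n b => Nat.bit b n) n * y := by
    intro l
    induction l with
    | nil => intro n; rfl
    | cons b l ih =>
      intro n
      rw [List.foldl_cons, List.foldl_cons, ← ih, Nat.bit_val]
      congr 1
      cases b <;> simp <;> ring
  simpa [ofDigits] using this l 0

theorem mulBits_eq (x y : ℕ) : mulBits x y = x * y := by
  rw [mulBits, foldl_mulBits, ofDigits_bits_reverse]

theorem size_le_of_lt {n k : ℕ} (h : n < 2 ^ k) : size n ≤ 2 * k + 1 := by
  rw [size_bits]
  have := Nat.size_le.2 h
  omega

@[fun_prop]
theorem PolyTime.mul {f g : α → ℕ} (hf : PolyTime f) (hg : PolyTime g) :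
    PolyTime fun a => f a * g a := by
  have : PolyTime fun a => mulBits (f a) (g a) := by
    refine PolyTime.foldl (l := fun a => (f a).bits.reverse)
      (f := fun a n b => n + n + bif b then g a else 0) (by fun_prop) (by fun_prop)
      ?_ (B := fun a => 2 * (StackProgram.size (f a) + StackProgram.size (g a)) + 1)
      (((PolyBd.const 2).mul (hf.size_bd.add hg.size_bd)).add (.const 1)) fun a l hl => ?_
    · have : PolyTime fun z : α × ℕ × Bool => g z.1 := hg.comp (by fun_prop)
      fun_prop
    · rw [foldl_mulBits]
      refine size_le_of_lt ?_
      have h1 : l.length ≤ StackProgram.size (f a) := by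
        have := hl.length_le
        rw [List.length_reverse, Nat.size_eq_bits_len] at this
        rw [size_bits]
        omega
      have h2 : Nat.size (g a) ≤ StackProgram.size (g a) := by rw [size_bits]; omega
      calc StackProgram.ofDigits l * g a < 2 ^ l.length * 2 ^ Nat.size (g a) :=
            Nat.mul_lt_mul'' (ofDigits_lt l) (Nat.lt_size_self _)
        _ = 2 ^ (l.length + Nat.size (g a)) := by rw [pow_add]
        _ ≤ _ := Nat.pow_le_pow_right (by omega) (by omega)
  simpa only [mulBits_eq] using this

/-- One step of the comparison of two numbers, from the least significant digit on. -/
def leStep (s : ℕ × ℕ × Bool) : ℕ × ℕ × Bool :=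
  (s.1.div2, s.2.1.div2, cond (Bool.xor s.1.bodd s.2.1.bodd) s.2.1.bodd s.2.2)

def leBits (x y : ℕ) : Bool :=
  ((x.bits ++ y.bits).foldl (fun s _ => leStep s) (x, y, true)).2.2

/-- The most significant differing digit decides, and the flag remembers the latest difference seen.
Invariant: the truth of "rest of `x` below rest of `y`, or rests equal and flag set". Once all
digits are consumed both rests are `0` and only the flag is left. -/
theorem leBits_eq (x y : ℕ) : leBits x y = decide (x ≤ y) := by
  have step : ∀ s : ℕ × ℕ × Bool,
      ((leStep s).1 < (leStep s).2.1 ∨ (leStep s).1 = (leStep s).2.1 ∧ (leStep s).2.2 = true) ↔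
        (s.1 < s.2.1 ∨ s.1 = s.2.1 ∧ s.2.2 = true) := by
    rintro ⟨x, y, r⟩
    have hx := Nat.bodd_add_div2 x
    have hy := Nat.bodd_add_div2 y
    simp only [leStep]
    generalize x.div2 = x' at *
    generalize y.div2 = y' at *
    generalize x.bodd = bx at *
    generalize y.bodd = by' at *
    cases bx <;> cases by' <;> cases r <;> simp at * <;> omega
  have fold : ∀ (l : List Bool) (s : ℕ × ℕ × Bool), s.1 < 2 ^ l.length → s.2.1 < 2 ^ l.length →
      ((l.foldl (fun s _ => leStep s) s).2.2 = true ↔ (s.1 < s.2.1 ∨ s.1 = s.2.1 ∧ s.2.2 = true)) := by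
    intro l
    induction l with
    | nil => intro s h1 h2; simp at h1 h2; simp [h1, h2]
    | cons b l ih =>
      intro s h1 h2
      rw [List.foldl_cons, ih, step]
      · simp only [leStep, Nat.div2_val]
        rw [List.length_cons, pow_succ] at h1
        omega
      · simp only [leStep, Nat.div2_val]
        rw [List.length_cons, pow_succ] at h2
        omega
  have hx := (lt_two_pow_bits x).trans_le
    (Nat.pow_le_pow_right (by omega) (Nat.le_add_right x.bits.length y.bits.length))
  have hy := (lt_two_pow_bits y).trans_le
    (Nat.pow_le_pow_right (by omega) (Nat.le_add_left y.bits.length x.bits.length))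
  rw [Bool.eq_iff_iff, leBits, fold _ _ (by simpa using hx) (by simpa using hy)]
  simp
  omega

@[fun_prop]
theorem PolyTime.le {f g : α → ℕ} (hf : PolyTime f) (hg : PolyTime g) :
    PolyTime fun a => decide (f a ≤ g a) := by
  have hstep : PolyTime leStep := by unfold leStep; fun_prop
  have : PolyTime fun a => leBits (f a) (g a) := by
    refine PolyTime.snd (.snd (PolyTime.foldl_of_growth
      (l := fun a => (f a).bits ++ (g a).bits) (f := fun _ s _ => leStep s)
      (by fun_prop) (by fun_prop) (hstep.comp (by fun_prop)) (.const 2) (fun _ _ => True)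
      (fun _ => trivial) fun _ x y _ _ => ⟨trivial, ?_⟩))
    have h1 := size_div2_le x.1
    have h2 := size_div2_le x.2.1
    simp [leStep]
    omega
  simpa only [leBits_eq] using this

end

/-! ### Further list operations. -/

section

variable {α β γ : Type} [Enc α] [Enc β] [Enc γ]

theorem size_append (l l' : List β) : size (l ++ l') + 1 = size l + size l' := by
  induction l with
  | nil => simp; omega
  | cons a l ih => simp; omega

theorem size_reverse (l : List β) : size l.reverse = size l := by
  induction l with
  | nil => rfl
  | cons a l ih =>
    have := size_append l.reverse [a]
    simp at this ⊢
    omega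

theorem PolyTime.flatMap {l : α → List β} {f : α → β → List γ} (hl : PolyTime l)
    (hf : PolyTime fun z : α × β => f z.1 z.2) : PolyTime fun a => (l a).flatMap (f a) := by
  obtain ⟨p, hp⟩ := hf.size_bd
  have : PolyTime fun a => (l a).reverse.foldl (fun out x => f a x ++ out) [] := by
    refine hl.reverse.foldl_of_growth (f := fun a out x => f a x ++ out) (by fun_prop)
      (.append (hf.comp (f := fun z : α × List γ × β => (z.1, z.2.2)) (by fun_prop)) (by fun_prop))
      ((PolyBd.self.add hl.size_bd).eval p) (fun _ _ => True) (fun _ => trivial)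
      fun a x y _ hy => ⟨trivial, ?_⟩
    have h1 := hp (a, y)
    have h2 := eval_mono p (m := StackProgram.size (a, y))
      (n := StackProgram.size a + StackProgram.size (l a)) (by
        have := size_le_of_mem (List.mem_reverse.1 hy)
        simp; omega)
    have h3 := size_append (f a y) x
    dsimp only at h1
    omega
  have h : ∀ a (l : List β), l.foldr (fun x out => f a x ++ out) [] = l.flatMap (f a) := by
    intro a l
    induction l with
    | nil => rfl
    | cons x l ih => simp [ih]
  simpa only [List.foldl_reverse, h] using this

def zipStep (s : List γ × List (β × γ)) (x : β) : List γ × List (β × γ) :=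
  match s.1 with
  | [] => s
  | y :: l => (l, (x, y) :: s.2)

theorem foldl_zipStep (l : List β) (l' : List γ) (out : List (β × γ)) :
    (l.foldl zipStep (l', out)).2 = (l.zip l').reverse ++ out := by
  induction l generalizing l' out with
  | nil => rfl
  | cons x l ih =>
    cases l' with
    | nil =>
      have : ∀ l : List β, l.foldl zipStep (([] : List γ), out) = ([], out) := by
        intro l
        induction l with
        | nil => rfl
        | cons x l ih => exact ih
      rw [this]
      rfl
    | cons y l' => rw [List.foldl_cons, zipStep, ih]; simp

@[fun_prop]
theorem PolyTime.zip [Inhabited γ] {l : α → List β} {l' : α → List γ} (hl : PolyTime l)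
    (hl' : PolyTime l') : PolyTime fun a => (l a).zip (l' a) := by
  have hstep : PolyTime fun z : α × (List γ × List (β × γ)) × β => zipStep z.2.1 z.2.2 := by
    have : PolyTime fun z : α × (List γ × List (β × γ)) × β => bif z.2.1.1.isEmpty then z.2.1 else
        (z.2.1.1.tail, (z.2.2, z.2.1.1.headI) :: z.2.1.2) := by fun_prop
    refine this.of_tk_eq fun ⟨_, ⟨l, _⟩, _⟩ => ?_
    cases l <;> rfl
  have : PolyTime fun a => ((l a).foldl zipStep (l' a, [])).2.reverse := by
    refine .reverse (.snd (hl.foldl_of_growth (f := fun _ s x => zipStep s x) (by fun_prop) hstep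
      (hl.size_bd.add (.const 2)) (fun _ _ => True) (fun _ => trivial)
      fun a s x _ hx => ⟨trivial, ?_⟩))
    have := size_le_of_mem hx
    obtain ⟨l, out⟩ := s
    cases l <;> simp [zipStep]
    omega
  simpa [foldl_zipStep] using this

/-! ### Unary numbers -/

/-- The unary representation of a number. -/
def unary (n : ℕ) : List Unit := List.replicate n ()

theorem size_unary (n : ℕ) : size (unary n) = 2 * n + 1 := by
  unfold unary
  induction n with
  | zero => rfl
  | succ n ih => rw [List.replicate_succ]; simp [ih]; omega

theorem eq_unary (u : List Unit) : u = unary u.length := List.eq_replicate_length.2 fun _ _ => rfl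

def clipStep (L : ℕ) (s : ℕ × List Unit) : ℕ × List Unit :=
  bif decide (L ≤ s.1) then s else (s.1 + 1, () :: s.2)

/-- `min n l.length` in unary. -/
def clip (n : ℕ) (l : List β) : List Unit := (l.foldl (fun s _ => clipStep n s) (0, [])).2

/-- Unary expansion of a binary number is exponential in general. Clipping at the length of a list
at hand keeps it polynomial on every input, malformed ones included, and changes nothing when the
list is long enough. -/
theorem clip_eq (n : ℕ) (l : List β) (h : n ≤ l.length) : clip n l = unary n := by
  have : ∀ (l : List β) (s : ℕ × List Unit), s.1 ≤ n → s.2.length = s.1 →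
      (l.foldl (fun s _ => clipStep n s) s).2.length = min n (s.1 + l.length) := by
    intro l
    induction l with
    | nil => intro s h1 h2; simp [h1, h2]
    | cons x l ih =>
      intro s h1 h2
      rw [List.foldl_cons]
      by_cases h : n ≤ s.1
      · have : clipStep n s = s := by simp [clipStep, h]
        rw [this, ih s h1 h2, List.length_cons]
        omega
      · have : clipStep n s = (s.1 + 1, () :: s.2) := by simp [clipStep, h]
        rw [this, ih _ (by simp; omega) (by simp [h2]), List.length_cons]
        simp only
        omega
  rw [eq_unary (clip n l), clip, this l _ (Nat.zero_le _) rfl]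
  simp [h]

theorem size_succ_le (n : ℕ) : size (n + 1) ≤ size n + 2 := by
  have := size_le_of_lt (n := n + 1) (k := Nat.size n + 1) (by
    have := Nat.lt_size_self n
    rw [pow_succ]
    omega)
  rw [size_bits n]
  omega

@[fun_prop]
theorem PolyTime.clip {f : α → ℕ} {l : α → List β} (hf : PolyTime f) (hl : PolyTime l) :
    PolyTime fun a => clip (f a) (l a) := by
  have : PolyTime fun z : α × (ℕ × List Unit) × β => f z.1 := hf.comp (by fun_prop)
  refine .snd (hl.foldl_of_growth (f := fun a s _ => clipStep (f a) s) (by fun_prop)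
    (by unfold clipStep; fun_prop) (.const 4) (fun _ _ => True) (fun _ => trivial)
    fun a s x _ _ => ⟨trivial, ?_⟩)
  by_cases h : f a ≤ s.1
  · have : clipStep (f a) s = s := by simp [clipStep, h]
    rw [this]; omega
  · have : clipStep (f a) s = (s.1 + 1, () :: s.2) := by simp [clipStep, h]
    have h1 := size_succ_le s.1
    rw [this]
    simp
    omega

/-! ### Parsers -/

/-- Apply a parser repeatedly, as many times as `u` says. -/
def many (p : α → List ℕ → β × List ℕ) (a : α) (u : List Unit) (r : List ℕ) : List β × List ℕ :=
  let s := u.foldl (fun (s : List β × List ℕ) _ => ((p a s.2).1 :: s.1, (p a s.2).2)) ([], r)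
  (s.1.reverse, s.2)

theorem many_eq {ξ : Type} (p : α → List ℕ → β × List ℕ) (a : α) (e : ξ → List ℕ) (v : ξ → β)
    (l : List ξ) (r : List ℕ) (h : ∀ x ∈ l, ∀ r, p a (e x ++ r) = (v x, r)) :
    many p a (unary l.length) (l.flatMap e ++ r) = (l.map v, r) := by
  have : ∀ (l : List ξ) (out : List β), (∀ x ∈ l, ∀ r, p a (e x ++ r) = (v x, r)) →
      (unary l.length).foldl (fun (s : List β × List ℕ) _ => ((p a s.2).1 :: s.1, (p a s.2).2))
        (out, l.flatMap e ++ r) = ((l.map v).reverse ++ out, r) := by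
    intro l
    induction l with
    | nil => intro out _; rfl
    | cons x l ih =>
      intro out h
      rw [List.length_cons, unary, List.replicate_succ, List.foldl_cons, List.flatMap_cons,
        List.append_assoc, h x List.mem_cons_self]
      rw [← unary, ih _ fun y hy => h y (List.mem_cons_of_mem _ hy)]
      simp
  rw [many, this l [] h]
  simp

/-- As the unread part never grows, each call of the parser sees an input of bounded size; this is
the invariant behind `PolyTime.many`. -/
theorem size_many_le {p : α → List ℕ → β × List ℕ} (h : ∀ a r, size (p a r).2 ≤ size r) (a : α)
    (u : List Unit) (r : List ℕ) : size (many p a u r).2 ≤ size r := by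
  have : ∀ (u : List Unit) (s : List β × List ℕ),
      size (u.foldl (fun (s : List β × List ℕ) _ => ((p a s.2).1 :: s.1, (p a s.2).2)) s).2 ≤
        size s.2 := by
    intro u
    induction u with
    | nil => intro s; exact le_rfl
    | cons x u ih => intro s; exact (ih _).trans (h a s.2)
  exact this u _

theorem PolyTime.many {p : α → List ℕ → β × List ℕ} (hp : PolyTime fun z : α × List ℕ => p z.1 z.2)
    (h : ∀ a r, StackProgram.size (p a r).2 ≤ StackProgram.size r)
    {f : γ → α} {u : γ → List Unit} {r : γ → List ℕ} (hf : PolyTime f) (hu : PolyTime u)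
    (hr : PolyTime r) : PolyTime fun c => many p (f c) (u c) (r c) := by
  obtain ⟨q, hq⟩ := hp.size_bd
  have h1 : PolyTime fun z : γ × (List β × List ℕ) × Unit => p (f z.1) z.2.1.2 :=
    hp.comp (f := fun z : γ × (List β × List ℕ) × Unit => (f z.1, z.2.1.2))
      (.prodMk (hf.comp (by fun_prop)) (by fun_prop))
  have : PolyTime fun c => (u c).foldl (fun (s : List β × List ℕ) _ =>
      ((p (f c) s.2).1 :: s.1, (p (f c) s.2).2)) ([], r c) := by
    refine hu.foldl_of_growth (f := fun c (s : List β × List ℕ) _ =>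
      ((p (f c) s.2).1 :: s.1, (p (f c) s.2).2)) (by fun_prop) (by fun_prop)
      (((hf.size_bd.add hr.size_bd).add (.const 1)).eval q)
      (fun c s => StackProgram.size s.2 ≤ StackProgram.size (r c)) (fun c => le_rfl)
      fun c s _ hs _ => ⟨(h _ _).trans hs, ?_⟩
    have h2 := hq (f c, s.2)
    have h3 := eval_mono q (m := StackProgram.size (f c, s.2))
      (n := StackProgram.size (f c) + StackProgram.size (r c) + 1) (by simp; omega)
    simp only [size_prod, size_cons] at h2 h3 ⊢
    omega
  exact .prodMk (.reverse this.fst) this.snd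

end

/-! ### Reading and writing numbers -/

/-- A symbol of the input or output word. -/
def symPair (o : Option Bool) : Bool × Bool := (o.isSome, o.getD false)

/-- The word is read from its end: the separator, which follows a number, opens a new digit list,
and each digit is put in front of the current one. -/
def parseNats (w : List (Bool × Bool)) : List (List Bool) :=
  w.reverse.foldl (fun acc s => bif s.1 then (s.2 :: acc.headI) :: acc.tail else [] :: acc) []

theorem parseNats_encodeNats (l : List ℕ) :
    parseNats ((FuzzyTransition.encodeNats l).map symPair) = l.map Nat.bits := by
  rw [parseNats, List.foldl_reverse, FuzzyTransition.encodeNats]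
  induction l with
  | nil => rfl
  | cons n l ih =>
    rw [List.flatMap_cons, List.map_append, List.foldr_append, ih]
    simp only [List.map_append, List.map_map, List.map_cons, List.map_nil, List.foldr_append]
    generalize n.bits = b
    induction b with
    | nil => rfl
    | cons x b ihb =>
      rw [List.map_cons, List.foldr_cons, ihb]
      rfl

/-- The numbers of an input word. -/
def readNats (w : List (Bool × Bool)) : List ℕ := (parseNats w).map fun l => ofDigits l.reverse

theorem readNats_encodeNats (l : List ℕ) :
    readNats ((FuzzyTransition.encodeNats l).map symPair) = l := by
  rw [readNats, parseNats_encodeNats, List.map_map]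
  simp [Function.comp_def, ofDigits_bits_reverse]

theorem PolyTime.readNats : PolyTime readNats := by
  have : PolyTime parseNats := by
    refine PolyTime.foldl_of_growth (l := fun w : List (Bool × Bool) => w.reverse)
      (f := fun _ (acc : List (List Bool)) s => bif s.1 then (s.2 :: acc.headI) :: acc.tail
        else [] :: acc) (by fun_prop) (by fun_prop) (by fun_prop) (.const 5) (fun _ _ => True)
      (fun _ => trivial) fun _ acc s _ _ => ⟨trivial, ?_⟩
    obtain ⟨b, b'⟩ := s
    have hd : size (default : List Bool) = 1 := rfl
    cases b <;> cases acc <;> simp [hd] <;> omega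
  exact this.map (f := fun _ l => StackProgram.ofDigits l.reverse) (by fun_prop)

/-- The word for a list of numbers. -/
def writeNats (l : List ℕ) : List (Bool × Bool) :=
  l.flatMap fun n => n.bits.map (fun b => (true, b)) ++ [(false, false)]

theorem writeNats_eq (l : List ℕ) :
    writeNats l = (FuzzyTransition.encodeNats l).map symPair := by
  rw [writeNats, FuzzyTransition.encodeNats, List.map_flatMap]
  simp [symPair, Function.comp_def]

theorem PolyTime.writeNats : PolyTime writeNats := by
  refine PolyTime.flatMap (l := fun l : List ℕ => l)
    (f := fun _ n => n.bits.map (fun b => (true, b)) ++ [(false, false)])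
    (by fun_prop) ?_
  have : PolyTime fun z : List ℕ × ℕ => z.2.bits.map (fun b => (true, b)) :=
    .map (f := fun _ b => (true, b)) (by fun_prop) (by fun_prop)
  fun_prop

/-! ### The iteration of the functional on lists of fractions. -/

/-- Fractions, as pairs of a numerator and a denominator. -/
abbrev Frac := ℕ × ℕ

def fle (p q : Frac) : Bool := decide (p.1 * q.2 ≤ q.1 * p.2)

def fmax (p q : Frac) : Frac := bif fle p q then q else p

def fmin (p q : Frac) : Frac := bif fle p q then p else q

/-- The starting values of `maxL` and `minL` are the conventions for empty families: a supremum is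
`0`, and the distance to the empty set is `1`. -/
def maxL (l : List Frac) : Frac := l.foldl fmax (0, 1)

def minL (l : List Frac) : Frac := l.foldl fmin (1, 1)

/-- The least entry of `row` at a position where `η` is at least `p`. -/
def nearest (p : Frac) (row η : List Frac) : Frac :=
  minL ((η.zip row).map fun x => bif fle p x.1 then x.2 else (1, 1))

/-- The cost of covering `μ` by `η`. -/
def cover (d : List (List Frac)) (μ η : List Frac) : Frac :=
  maxL ((μ.zip d).map fun x => fmin x.1 (nearest x.1 x.2 η))

/-- Closed formula for the lifted distance, with no search over couplings. The same `d` serves both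
covering costs because it is symmetric where the formula is used. -/
def liftL (d : List (List Frac)) (μ η : List Frac) : Frac :=
  bif fle (maxL μ) (maxL η) && fle (maxL η) (maxL μ) then fmax (cover d μ η) (cover d η μ)
  else (1, 1)

def distL (d : List (List Frac)) (μ : List Frac) (Z : List (List Frac)) : Frac :=
  minL (Z.map fun η => liftL d μ η)

def hausL (d : List (List Frac)) (Y Z : List (List Frac)) : Frac :=
  fmax (maxL (Y.map fun μ => distL d μ Z)) (maxL (Z.map fun η => distL d η Y))

def rowDistL (d : List (List Frac)) (r r' : List (List (List Frac))) : Frac :=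
  maxL ((r.zip r').map fun x => hausL d x.1 x.2)

def scale (a b : ℕ) (p : Frac) : Frac := (a * p.1, b * p.2)

/-- The transitions of a system: for every state and label a list of fuzzy sets. -/
abbrev Table := List (List (List (List Frac)))

def stepL (a b : ℕ) (T : Table) (d : List (List Frac)) : List (List Frac) :=
  T.map fun r => T.map fun r' => scale a b (rowDistL d r r')

def zeroL (T : Table) : List (List Frac) := T.map fun _ => T.map fun _ => (0, 1)

/-- The list that is folded over serves only as a counter of length `|S|²`. -/
def iterL (a b : ℕ) (T : Table) : List (List Frac) :=
  (T.flatMap fun _ => T).foldl (fun d _ => stepL a b T d) (zeroL T)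

section

variable {α : Type} [Enc α]

@[fun_prop]
theorem PolyTime.fle {f g : α → Frac} (hf : PolyTime f) (hg : PolyTime g) :
    PolyTime fun a => fle (f a) (g a) := by
  unfold StackProgram.fle; fun_prop

@[fun_prop]
theorem PolyTime.fmax {f g : α → Frac} (hf : PolyTime f) (hg : PolyTime g) :
    PolyTime fun a => fmax (f a) (g a) := by
  unfold StackProgram.fmax; fun_prop

@[fun_prop]
theorem PolyTime.fmin {f g : α → Frac} (hf : PolyTime f) (hg : PolyTime g) :
    PolyTime fun a => fmin (f a) (g a) := by
  unfold StackProgram.fmin; fun_prop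

theorem fmax_eq_or (p q : Frac) : fmax p q = p ∨ fmax p q = q := by
  unfold fmax; cases fle p q <;> simp

theorem fmin_eq_or (p q : Frac) : fmin p q = p ∨ fmin p q = q := by
  unfold fmin; cases fle p q <;> simp

/-- Maxima and minima select one of their arguments unchanged, so they never create longer
fractions. -/
theorem foldl_pick {β : Type} {op : β → β → β} (h : ∀ x y, op x y = x ∨ op x y = y) (l : List β)
    (b : β) : l.foldl op b = b ∨ l.foldl op b ∈ l := by
  induction l generalizing b with
  | nil => exact Or.inl rfl
  | cons x l ih =>
    rw [List.foldl_cons]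
    rcases ih (op b x) with h1 | h1
    · rcases h b x with h2 | h2
      · exact Or.inl (h1.trans h2)
      · exact Or.inr (by rw [h1, h2]; exact List.mem_cons_self)
    · exact Or.inr (List.mem_cons_of_mem _ h1)

theorem PolyTime.foldl_pick {op : Frac → Frac → Frac} (hop : PolyTime fun z : Frac × Frac => op z.1 z.2)
    (h : ∀ x y, op x y = x ∨ op x y = y) (b : Frac) {l : α → List Frac} (hl : PolyTime l) :
    PolyTime fun a => (l a).foldl op b := by
  refine hl.foldl (f := fun _ => op) (by fun_prop)
    (hop.comp (f := fun z : α × Frac × Frac => z.2) (by fun_prop))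
    (B := fun a => StackProgram.size b + StackProgram.size (l a)) ((PolyBd.const _).add hl.size_bd)
    fun a l' hl' => ?_
  rcases StackProgram.foldl_pick h l' b with h1 | h1
  · rw [h1]; omega
  · have := size_le_of_mem (hl'.subset h1)
    omega

@[fun_prop]
theorem PolyTime.maxL {l : α → List Frac} (hl : PolyTime l) : PolyTime fun a => maxL (l a) :=
  .foldl_pick (by fun_prop) fmax_eq_or _ hl

@[fun_prop]
theorem PolyTime.minL {l : α → List Frac} (hl : PolyTime l) : PolyTime fun a => minL (l a) :=
  .foldl_pick (by fun_prop) fmin_eq_or _ hl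

variable {d : α → List (List Frac)} {μ η : α → List Frac}

@[fun_prop]
theorem PolyTime.nearest {p : α → Frac} {row : α → List Frac} (hp : PolyTime p)
    (hr : PolyTime row) (hη : PolyTime η) : PolyTime fun a => nearest (p a) (row a) (η a) := by
  have h1 : PolyTime fun a => (η a).zip (row a) := by fun_prop
  have h2 : PolyTime fun z : α × Frac × Frac =>
      bif StackProgram.fle (p z.1) z.2.1 then z.2.2 else (1, 1) := by fun_prop
  unfold StackProgram.nearest
  refine .minL (.map h1 ?_)
  exact h2

@[fun_prop]
theorem PolyTime.cover (hd : PolyTime d) (hμ : PolyTime μ) (hη : PolyTime η) :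
    PolyTime fun a => cover (d a) (μ a) (η a) := by
  have h1 : PolyTime fun a => (μ a).zip (d a) := by fun_prop
  have h2 : PolyTime fun z : α × Frac × List Frac =>
      StackProgram.fmin z.2.1 (StackProgram.nearest z.2.1 z.2.2 (η z.1)) := by fun_prop
  unfold StackProgram.cover
  refine .maxL (.map h1 ?_)
  exact h2

@[fun_prop]
theorem PolyTime.liftL (hd : PolyTime d) (hμ : PolyTime μ) (hη : PolyTime η) :
    PolyTime fun a => liftL (d a) (μ a) (η a) := by
  unfold StackProgram.liftL; fun_prop

@[fun_prop]
theorem PolyTime.distL (hd : PolyTime d) (hμ : PolyTime μ) {Z : α → List (List Frac)}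
    (hZ : PolyTime Z) : PolyTime fun a => distL (d a) (μ a) (Z a) := by
  unfold StackProgram.distL
  exact .minL (.map (f := fun a η => StackProgram.liftL (d a) (μ a) η) hZ (by fun_prop))

@[fun_prop]
theorem PolyTime.hausL (hd : PolyTime d) {Y Z : α → List (List Frac)} (hY : PolyTime Y)
    (hZ : PolyTime Z) : PolyTime fun a => hausL (d a) (Y a) (Z a) := by
  unfold StackProgram.hausL
  exact .fmax (.maxL (.map (f := fun a μ => StackProgram.distL (d a) μ (Z a)) hY (by fun_prop)))
    (.maxL (.map (f := fun a μ => StackProgram.distL (d a) μ (Y a)) hZ (by fun_prop)))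

@[fun_prop]
theorem PolyTime.rowDistL (hd : PolyTime d) {r r' : α → List (List (List Frac))} (hr : PolyTime r)
    (hr' : PolyTime r') : PolyTime fun a => rowDistL (d a) (r a) (r' a) := by
  have h1 : PolyTime fun a => (r a).zip (r' a) := by fun_prop
  have h2 : PolyTime fun z : α × List (List Frac) × List (List Frac) =>
      StackProgram.hausL (d z.1) z.2.1 z.2.2 := by fun_prop
  unfold StackProgram.rowDistL
  refine .maxL (.map h1 ?_)
  exact h2

@[fun_prop]
theorem PolyTime.scale (a b : ℕ) {f : α → Frac} (hf : PolyTime f) :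
    PolyTime fun x => scale a b (f x) := by
  unfold StackProgram.scale; fun_prop

@[fun_prop]
theorem PolyTime.stepL (a b : ℕ) {T : α → Table} (hT : PolyTime T) (hd : PolyTime d) :
    PolyTime fun x => stepL a b (T x) (d x) := by
  have h1 : PolyTime fun z : (α × List (List (List Frac))) × List (List (List Frac)) =>
      StackProgram.scale a b (StackProgram.rowDistL (d z.1.1) z.1.2 z.2) := by fun_prop
  have h2 : PolyTime fun z : α × List (List (List Frac)) => T z.1 := by fun_prop
  unfold StackProgram.stepL
  refine .map hT (.map h2 ?_)
  exact h1

@[fun_prop]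
theorem PolyTime.zeroL {T : α → Table} (hT : PolyTime T) : PolyTime fun x => zeroL (T x) := by
  have : PolyTime fun x => (T x).map fun _ => ((0, 1) : Frac) :=
    hT.map (f := fun _ _ => (0, 1)) (by fun_prop)
  exact hT.map (f := fun x _ => (T x).map fun _ => ((0, 1) : Frac)) (by fun_prop)

end

/-! ### Growth of the fractions under iteration. -/

section

variable {P : Frac → Prop}

theorem maxL_of_forall (h0 : P (0, 1)) {l : List Frac} (h : ∀ p ∈ l, P p) : P (maxL l) := by
  rcases foldl_pick fmax_eq_or l (0, 1) with h1 | h1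
  · rw [maxL, h1]; exact h0
  · exact h _ h1

theorem minL_of_forall (h0 : P (1, 1)) {l : List Frac} (h : ∀ p ∈ l, P p) : P (minL l) := by
  rcases foldl_pick fmin_eq_or l (1, 1) with h1 | h1
  · rw [minL, h1]; exact h0
  · exact h _ h1

theorem fmax_of {p q : Frac} (hp : P p) (hq : P q) : P (fmax p q) := by
  rcases fmax_eq_or p q with h | h <;> rw [h] <;> assumption

theorem fmin_of {p q : Frac} (hp : P p) (hq : P q) : P (fmin p q) := by
  rcases fmin_eq_or p q with h | h <;> rw [h] <;> assumption

variable (h0 : P (0, 1)) (h1 : P (1, 1)) {d : List (List Frac)} (hd : ∀ r ∈ d, ∀ p ∈ r, P p)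

include h0 h1 hd

theorem cover_of_forall {μ η : List Frac} (hμ : ∀ p ∈ μ, P p) : P (cover d μ η) := by
  refine maxL_of_forall h0 fun p hp => ?_
  obtain ⟨x, hx, rfl⟩ := List.mem_map.1 hp
  obtain ⟨hx1, hx2⟩ := List.of_mem_zip (show (x.1, x.2) ∈ μ.zip d from hx)
  refine fmin_of (hμ _ hx1) (minL_of_forall h1 fun q hq => ?_)
  obtain ⟨y, hy, rfl⟩ := List.mem_map.1 hq
  obtain ⟨hy1, hy2⟩ := List.of_mem_zip (show (y.1, y.2) ∈ η.zip x.2 from hy)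
  cases fle x.1 y.1
  · exact h1
  · exact hd _ hx2 _ hy2

theorem distL_of_forall {μ : List Frac} {Z : List (List Frac)} (hμ : ∀ p ∈ μ, P p)
    (hZ : ∀ η ∈ Z, ∀ p ∈ η, P p) : P (distL d μ Z) := by
  refine minL_of_forall h1 fun p hp => ?_
  obtain ⟨η, hη, rfl⟩ := List.mem_map.1 hp
  unfold liftL
  cases fle (maxL μ) (maxL η) && fle (maxL η) (maxL μ)
  · exact h1
  · exact fmax_of (cover_of_forall h0 h1 hd hμ) (cover_of_forall h0 h1 hd (hZ _ hη))

theorem rowDistL_of_forall {r r' : List (List (List Frac))}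
    (hr : ∀ Y ∈ r, ∀ μ ∈ Y, ∀ p ∈ μ, P p) (hr' : ∀ Y ∈ r', ∀ μ ∈ Y, ∀ p ∈ μ, P p) :
    P (rowDistL d r r') := by
  refine maxL_of_forall h0 fun p hp => ?_
  obtain ⟨x, hx, rfl⟩ := List.mem_map.1 hp
  obtain ⟨hx1, hx2⟩ := List.of_mem_zip (show (x.1, x.2) ∈ r.zip r' from hx)
  refine fmax_of (maxL_of_forall h0 fun q hq => ?_) (maxL_of_forall h0 fun q hq => ?_)
  all_goals obtain ⟨μ, hμ, rfl⟩ := List.mem_map.1 hq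
  · exact distL_of_forall h0 h1 hd (hr _ hx1 _ hμ) (hr' _ hx2)
  · exact distL_of_forall h0 h1 hd (hr' _ hx2 _ hμ) (hr _ hx1)

/-- Before the final scaling every entry is `0`, `1`, an old entry or a membership degree. Any
property shared by these, such as a bound on the size, therefore passes to the unscaled new entries.
-/
theorem stepL_of_forall {a b : ℕ} {T : Table} (hT : ∀ r ∈ T, ∀ Y ∈ r, ∀ μ ∈ Y, ∀ p ∈ μ, P p) :
    ∀ r ∈ stepL a b T d, ∀ p ∈ r, ∃ q, P q ∧ p = scale a b q := by
  intro r hr p hp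
  obtain ⟨s, hs, rfl⟩ := List.mem_map.1 hr
  obtain ⟨s', hs', rfl⟩ := List.mem_map.1 hp
  exact ⟨_, rowDistL_of_forall h0 h1 hd (hT _ hs) (hT _ hs'), rfl⟩

end

theorem foldl_const {β γ : Type} (f : β → β) (l : List γ) (b : β) :
    l.foldl (fun x _ => f x) b = f^[l.length] b := by
  induction l generalizing b with
  | nil => rfl
  | cons x l ih => rw [List.foldl_cons, ih, List.length_cons, Function.iterate_succ_apply]

theorem length_flatMap_const {β γ : Type} (l : List β) (l' : List γ) :
    (l.flatMap fun _ => l').length = l.length * l'.length := by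
  induction l with
  | nil => simp
  | cons x l ih => simp [ih, Nat.succ_mul, Nat.add_comm]

theorem iterL_eq (a b : ℕ) (T : Table) :
    iterL a b T = (stepL a b T)^[T.length * T.length] (zeroL T) := by
  rw [iterL, foldl_const, length_flatMap_const]

theorem size_mul_le (m n : ℕ) : size (m * n) ≤ size m + size n := by
  have : m * n < 2 ^ (Nat.size m + Nat.size n) := by
    rw [pow_add]
    exact Nat.mul_lt_mul'' (Nat.lt_size_self _) (Nat.lt_size_self _)
  have := size_le_of_lt this
  rw [size_bits m, size_bits n]
  omega

/-- Fractions are never reduced: each iteration multiplies the numerator by `a` and the denominator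
by `b`, adding at most `size a + size b`. The summand `10` is a generous bound for the sizes of
`0/1` and `1/1`. -/
theorem size_iterate_stepL_le (a b : ℕ) (T : Table) (i : ℕ) :
    size ((stepL a b T)^[i] (zeroL T)) ≤
      size T * (size T * ((size T + 10 + i * (size a + size b)) + 1) + 2) + 1 := by
  have hT : ∀ r ∈ T, ∀ Y ∈ r, ∀ μ ∈ Y, ∀ p ∈ μ, size p ≤ size T := by
    intro r hr Y hY μ hμ p hp
    have h1 := size_le_of_mem hr
    have h2 := size_le_of_mem hY
    have h3 := size_le_of_mem hμ
    have h4 := size_le_of_mem hp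
    omega
  have h01 : size ((0, 1) : Frac) ≤ 10 := by decide
  have h11 : size ((1, 1) : Frac) ≤ 10 := by decide
  have key : ((stepL a b T)^[i] (zeroL T)).length ≤ size T ∧
      (∀ r ∈ (stepL a b T)^[i] (zeroL T), r.length ≤ size T ∧
        ∀ p ∈ r, size p ≤ size T + 10 + i * (size a + size b)) := by
    have hlen := (length_lt_size T).le
    induction i with
    | zero =>
      refine ⟨by simpa [zeroL] using hlen, fun r hr => ?_⟩
      obtain ⟨_, _, rfl⟩ := List.mem_map.1 hr
      refine ⟨by simpa using hlen, fun p hp => ?_⟩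
      obtain ⟨_, _, rfl⟩ := List.mem_map.1 hp
      omega
    | succ i ih =>
      rw [Function.iterate_succ_apply']
      refine ⟨by simpa [stepL] using hlen, fun r hr => ⟨?_, ?_⟩⟩
      · obtain ⟨_, _, rfl⟩ := List.mem_map.1 hr
        simpa using hlen
      · intro p hp
        obtain ⟨q, hq, rfl⟩ := stepL_of_forall
          (P := fun p => size p ≤ size T + 10 + i * (size a + size b)) (by omega) (by omega)
          (fun r hr => (ih.2 r hr).2) (fun r hr Y hY μ hμ p hp => by
            have := hT r hr Y hY μ hμ p hp
            omega) r hr p hp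
        have h1 := size_mul_le a q.1
        have h2 := size_mul_le b q.2
        rw [scale, size_prod]
        rw [size_prod] at hq
        rw [Nat.succ_mul]
        dsimp only
        omega
  generalize size T + 10 + i * (size a + size b) = E at *
  have hrow : ∀ r ∈ (stepL a b T)^[i] (zeroL T), size r ≤ size T * (E + 1) + 1 := fun r hr =>
    (size_le_of_forall (key.2 r hr).2).trans
      (Nat.add_le_add_right (Nat.mul_le_mul_right _ (key.2 r hr).1) 1)
  exact (size_le_of_forall hrow).trans (Nat.add_le_add_right (Nat.mul_le_mul_right _ key.1) 1)

theorem PolyTime.iterL (a b : ℕ) {α : Type} [Enc α] {T : α → Table} (hT : PolyTime T) :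
    PolyTime fun x => iterL a b (T x) := by
  have hl : PolyTime fun x => (T x).flatMap fun _ => T x :=
    .flatMap (f := fun x _ => T x) hT (by fun_prop)
  refine hl.foldl (f := fun x d _ => StackProgram.stepL a b (T x) d) (by fun_prop) (by fun_prop)
    (B := fun x => StackProgram.size (T x) * (StackProgram.size (T x) * ((StackProgram.size (T x) +
      10 + StackProgram.size ((T x).flatMap fun _ => T x) * (StackProgram.size a +
        StackProgram.size b)) + 1) + 2) + 1) ?_ fun x l' hl' => ?_
  · have h := hT.size_bd
    exact (h.mul ((h.mul (((h.add (.const 10)).add (hl.size_bd.mul (.const _))).add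
      (.const 1))).add (.const 2))).add (.const 1)
  · rw [foldl_const]
    refine (size_iterate_stepL_le a b (T x) l'.length).trans ?_
    have := hl'.length_le.trans (length_lt_size _).le
    gcongr

open FuzzyTransition

/-! ### From numbers to tables -/

def parsePair (_ : Unit) (r : List ℕ) : Frac × List ℕ := ((r.headI, r.tail.headI), r.tail.tail)

def parseVec (u : List Unit) (r : List ℕ) : List Frac × List ℕ := many parsePair () u r

def parseSet (u : List Unit) (r : List ℕ) : List (List Frac) × List ℕ :=
  many parseVec u (clip r.headI r) r.tail

def parseRow (c : List Unit × List Unit) (r : List ℕ) : List (List (List Frac)) × List ℕ :=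
  many parseSet c.1 c.2 r

/-- The table of a system with `u.length` states that is described by the numbers `l`. -/
def parseTable (u : List Unit) (l : List ℕ) : Table :=
  (many parseRow (u, clip l.tail.headI l) u l.tail.tail).1

theorem size_tail_le {β : Type} [Enc β] (l : List β) : size l.tail ≤ size l := by
  cases l <;> simp
  omega

theorem PolyTime.parsePair : PolyTime fun z : Unit × List ℕ => parsePair z.1 z.2 := by
  unfold StackProgram.parsePair; fun_prop

theorem size_parsePair_le (a : Unit) (r : List ℕ) : size (parsePair a r).2 ≤ size r :=
  (size_tail_le _).trans (size_tail_le _)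

theorem PolyTime.parseVec : PolyTime fun z : List Unit × List ℕ => parseVec z.1 z.2 :=
  PolyTime.parsePair.many size_parsePair_le (by fun_prop) (by fun_prop) (by fun_prop)

theorem size_parseVec_le (u : List Unit) (r : List ℕ) : size (parseVec u r).2 ≤ size r :=
  size_many_le size_parsePair_le _ _ _

theorem PolyTime.parseSet : PolyTime fun z : List Unit × List ℕ => parseSet z.1 z.2 :=
  PolyTime.parseVec.many size_parseVec_le (by fun_prop) (by fun_prop) (by fun_prop)

theorem size_parseSet_le (u : List Unit) (r : List ℕ) : size (parseSet u r).2 ≤ size r :=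
  (size_many_le size_parseVec_le _ _ _).trans (size_tail_le _)

theorem PolyTime.parseRow :
    PolyTime fun z : (List Unit × List Unit) × List ℕ => parseRow z.1 z.2 :=
  PolyTime.parseSet.many size_parseSet_le (by fun_prop) (by fun_prop) (by fun_prop)

theorem size_parseRow_le (c : List Unit × List Unit) (r : List ℕ) :
    size (parseRow c r).2 ≤ size r :=
  size_many_le size_parseSet_le _ _ _

theorem PolyTime.parseTable : PolyTime fun z : List Unit × List ℕ => parseTable z.1 z.2 :=
  .fst (PolyTime.parseRow.many size_parseRow_le (f := fun z : List Unit × List ℕ =>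
    (z.1, StackProgram.clip z.2.tail.headI z.2)) (by fun_prop) (by fun_prop) (by fun_prop))

def fracOf (q : Degree) : Frac := (q.num, q.den)

def vecOf {n : ℕ} (μ : Fin n → Degree) : List Frac := (List.finRange n).map fun x => fracOf (μ x)

/-- The transitions of a system. -/
def tableOf (M : RationalFTS) : Table :=
  (List.finRange M.n).map fun s => (List.finRange M.k).map fun a => (M.trans s a).map vecOf

/-- The numbers that describe a system. -/
def numsOf (M : RationalFTS) : List ℕ :=
  M.n :: M.k :: (List.finRange M.n).flatMap fun s => (List.finRange M.k).flatMap fun a =>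
    (M.trans s a).length :: (M.trans s a).flatMap fun μ =>
      (List.finRange M.n).flatMap fun x => [(μ x).num, (μ x).den]

theorem parseVec_eq {n : ℕ} (μ : Fin n → Degree) (r : List ℕ) :
    parseVec (unary n) (((List.finRange n).flatMap fun x => [(μ x).num, (μ x).den]) ++ r) =
      (vecOf μ, r) := by
  have := many_eq parsePair () (fun x => [(μ x).num, (μ x).den]) (fun x => fracOf (μ x))
    (List.finRange n) r fun x _ r => rfl
  rwa [List.length_finRange] at this

theorem length_le_length_flatMap {β γ : Type} {l : List β} {f : β → List γ}
    (h : ∀ x ∈ l, 1 ≤ (f x).length) : l.length ≤ (l.flatMap f).length := by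
  induction l with
  | nil => simp
  | cons x l ih =>
    have h1 := h x List.mem_cons_self
    have h2 := ih fun y hy => h y (List.mem_cons_of_mem _ hy)
    rw [List.flatMap_cons, List.length_append, List.length_cons]
    omega

theorem length_le_length_flatMap_of_mem {β γ : Type} {l : List β} {f : β → List γ} {x : β}
    (h : x ∈ l) : (f x).length ≤ (l.flatMap f).length := by
  obtain ⟨l, l', rfl⟩ := List.append_of_mem h
  rw [List.flatMap_append, List.flatMap_cons, List.length_append, List.length_append]
  omega

/-- With at least one state every fuzzy set contributes a number to the input, so the cardinality of
`Y` is at most the length of the list and clipping is harmless. Without states this would fail. -/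
theorem parseSet_eq {n : ℕ} (hn : 0 < n) (Y : List (Fin n → Degree)) (r : List ℕ) :
    parseSet (unary n) ((Y.length :: Y.flatMap fun μ =>
      (List.finRange n).flatMap fun x => [(μ x).num, (μ x).den]) ++ r) = (Y.map vecOf, r) := by
  have h := length_le_length_flatMap (l := Y)
    (f := fun μ => (List.finRange n).flatMap fun x => [(μ x).num, (μ x).den]) fun μ _ =>
    (by rw [List.length_finRange]; exact hn : 1 ≤ (List.finRange n).length).trans
      (length_le_length_flatMap fun x _ => by simp)
  rw [parseSet, List.cons_append, List.headI_cons, List.tail_cons, clip_eq]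
  · exact many_eq parseVec (unary n) _ vecOf Y r fun μ _ r => parseVec_eq μ r
  · rw [List.length_cons, List.length_append]
    omega

theorem parseTable_eq (M : RationalFTS) : parseTable (unary M.n) (numsOf M) = tableOf M := by
  rcases Nat.eq_zero_or_pos M.n with hn | hn
  · have h1 : tableOf M = [] := by
      rw [tableOf, List.map_eq_nil_iff, ← List.length_eq_zero_iff, List.length_finRange, hn]
    rw [h1, hn]
    rfl
  · rw [parseTable, numsOf, List.tail_cons, List.headI_cons, List.tail_cons, clip_eq]
    · have := many_eq parseRow (unary M.n, unary M.k)
        (fun s => (List.finRange M.k).flatMap fun a =>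
          (M.trans s a).length :: (M.trans s a).flatMap fun μ =>
            (List.finRange M.n).flatMap fun x => [(μ x).num, (μ x).den])
        (fun s => (List.finRange M.k).map fun a => (M.trans s a).map vecOf)
        (List.finRange M.n) [] fun s _ r => by
          have := many_eq parseSet (unary M.n)
            (fun a => (M.trans s a).length :: (M.trans s a).flatMap fun μ =>
              (List.finRange M.n).flatMap fun x => [(μ x).num, (μ x).den])
            (fun a => (M.trans s a).map vecOf) (List.finRange M.k) r
            fun a _ r => parseSet_eq hn _ r
          rwa [List.length_finRange] at this
      rw [List.length_finRange, List.append_nil] at this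
      rw [this]
      rfl
    -- Each label contributes at least one number, a cardinality, to the block of state `0`; hence
    -- clipping does not alter the number of labels.
    · have : (List.finRange M.k).length ≤ _ := length_le_length_flatMap
        (l := List.finRange M.k) (f := fun a => (M.trans ⟨0, hn⟩ a).length ::
          (M.trans ⟨0, hn⟩ a).flatMap fun μ =>
            (List.finRange M.n).flatMap fun x => [(μ x).num, (μ x).den]) fun a _ => by simp
      rw [List.length_finRange] at this
      refine this.trans ?_
      rw [List.length_cons, List.length_cons]
      refine le_trans ?_ (Nat.le_add_right _ 2)
      exact length_le_length_flatMap_of_mem (f := fun s => (List.finRange M.k).flatMap fun a =>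
        (M.trans s a).length :: (M.trans s a).flatMap fun μ =>
          (List.finRange M.n).flatMap fun x => [(μ x).num, (μ x).den])
        (List.mem_finRange (⟨0, hn⟩ : Fin M.n))

/-- The word of the final matrix for a system with `z.1.length` states described by `z.2`. -/
def outputOf (a b : ℕ) (z : List Unit × List ℕ) : List (Bool × Bool) :=
  writeNats ((iterL a b (parseTable z.1 z.2)).flatMap fun r => r.flatMap fun p => [p.1, p.2])

theorem PolyTime.outputOf (a b : ℕ) : PolyTime (outputOf a b) := by
  have h1 : PolyTime fun z : List Unit × List ℕ =>
      StackProgram.iterL a b (StackProgram.parseTable z.1 z.2) := .iterL a b .parseTable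
  have h2 : PolyTime fun r : (List Unit × List ℕ) × List Frac => r.2.flatMap fun p => [p.1, p.2] := by
    refine .flatMap (by fun_prop) ?_
    fun_prop
  exact PolyTime.writeNats.comp (.flatMap h1 h2)

/-! ### The unary representation of the first number -/

def doubleStep (s : List Unit × List ℕ) (b : Bool) : List Unit × List ℕ :=
  (bif b then () :: (s.1 ++ s.1) else s.1 ++ s.1, s.2)

theorem foldl_doubleStep (l : List Bool) (k : ℕ) (r : List ℕ) :
    l.foldl doubleStep (unary k, r) = (unary (l.foldl (fun n b => Nat.bit b n) k), r) := by
  induction l generalizing k with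
  | nil => rfl
  | cons b l ih =>
    have : doubleStep (unary k, r) b = (unary (Nat.bit b k), r) := by
      refine Prod.ext ?_ rfl
      rw [eq_unary (doubleStep (unary k, r) b).1]
      congr 1
      cases b <;> simp [doubleStep, unary, Nat.bit_val] <;> omega
    rw [List.foldl_cons, List.foldl_cons, this, ih]

/-- The number of states cannot be clipped: without labels the input consists of two numbers only.
Here the time is polynomial in the value of the first number as well, so this is no instance of
`PolyTime`. -/
theorem exists_unary_program : ∃ (c : Cmd) (p : Polynomial ℕ), ∀ (l : List ℕ) (m : List Sym),
    MRun c (tk l ++ m) (tk (unary l.headI, l) ++ m) (p.eval (size l + l.headI)) := by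
  have h1 : PolyTime fun l : List ℕ => (l.headI.bits.reverse, (([] : List Unit), l)) := by fun_prop
  have h2 : PolyTime fun z : (List Unit × List ℕ) × Bool => doubleStep z.1 z.2 := by
    unfold doubleStep; fun_prop
  obtain ⟨c, p, hc⟩ := h1
  obtain ⟨d, q, hd⟩ := h2
  have hB : PolyBd (fun l : List ℕ => size l + l.headI) fun l => 2 * (size l + l.headI) + 3 :=
    ((PolyBd.const 2).mul .self).add (.const 3)
  obtain ⟨P, hP⟩ := (PolyBd.self.eval p).add ((PolyBd.const 1).add
    ((hB.mul ((((PolyBd.const 28).mul hB).add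
      ((((PolyBd.const 2).mul hB).add (.const 1)).eval q)).add (.const 17))).add (.const 2)))
  refine ⟨c ;; .pop 0 ;; foldCmd d, P, fun l m => .mono ?_ (hP l)⟩
  refine .seq ((hc l m).mono (eval_mono p (Nat.le_add_right _ _))) (.seq (unpair_run _ _ _) ?_)
  have h3 := foldl_doubleStep l.headI.bits.reverse 0 l
  rw [← ofDigits, ofDigits_bits_reverse] at h3
  have h4 : size l.headI ≤ size l := by
    cases l with
    | nil => exact le_rfl
    | cons n l => simp; omega
  have h5 := foldCmd_run (f := doubleStep) (c := d) (p := q) hd l.headI.bits.reverse (unary 0, l)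
    (2 * (size l + l.headI) + 3) (by rw [size_reverse, ← size_nat]; omega) (fun l' hl' => ?_) m
  · rw [h3] at h5
    exact h5
  · obtain ⟨t, ht⟩ := hl'
    -- A leading segment of the binary digits denotes a smaller number, so no intermediate unary
    -- number exceeds the final one.
    have h6 : ofDigits l' ≤ l.headI := by
      rw [← ofDigits_bits_reverse l.headI, ← ht, ofDigits, ofDigits, List.foldl_append,
        foldl_bit t]
      exact (Nat.le_mul_of_pos_right _ (by positivity)).trans (Nat.le_add_right _ _)
    rw [foldl_doubleStep, ← ofDigits, size_prod, size_unary]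
    dsimp only
    omega

/-! ### Input and output -/

/-- Turn the input word into the list of its symbols. -/
def readInput : Cmd :=
  moveAll 0 1 ;; .push 0 (some false) ;; .loop 1 Option.isSome
    (.ite 1 (· == some none) (.push 0 (some false) ;; .push 0 (some false))
      (.copy 1 0 ;; .push 0 (some true)) ;; .push 0 none ;; .push 0 none ;; .pop 1)

theorem readInput_run (w : List Sym) :
    MRun readInput w (tk (w.map symPair)) (9 * w.length + 4) := by
  have key : ∀ (a : List Sym) (l : List (Bool × Bool)), Run (.loop 1 Option.isSome
      (.ite 1 (· == some none) (.push 0 (some false) ;; .push 0 (some false))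
        (.copy 1 0 ;; .push 0 (some true)) ;; .push 0 none ;; .push 0 none ;; .pop 1))
      (st (tk l) a [] []) (st (tk (a.reverse.map symPair ++ l)) [] [] []) (7 * a.length + 1) := by
    intro a
    induction a with
    | nil => intro l; exact .loop_done rfl
    | cons x a ih =>
      intro l
      have h := ih (symPair x :: l)
      cases x with
      | none =>
        refine .mono (.loop_step rfl (.seq (.ite_true rfl (.seq (.push 0 _ _) (.push 0 _ _)))
          (.seq (.push 0 _ _) (.seq (.push 0 _ _) (.pop 1 _)))) (t' := 7 * a.length + 1) ?_)
          (by simp; omega)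
        simpa [symPair] using h
      | some b =>
        refine .mono (.loop_step rfl (.seq (.ite_false rfl (.seq (.copy 1 0 _) (.push 0 _ _)))
          (.seq (.push 0 _ _) (.seq (.push 0 _ _) (.pop 1 _)))) (t' := 7 * a.length + 1) ?_)
          (by simp; omega)
        simpa [symPair] using h
  have h1 := moveAll_run (by decide : (0 : Fin 4) ≠ 1) (st w [] [] [])
  simp only [st_zero, st_one, update_st_zero, update_st_one, List.append_nil] at h1
  refine .mono (.seq h1 (.seq (.push 0 _ _) (t' := 7 * w.length + 1) ?_)) (by omega)
  simpa using key w.reverse []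

/-- Turn a list of symbols into the output word. -/
def writeOutput : Cmd :=
  .loop 0 (· == some none) (.pop 0 ;; .pop 0 ;; .ite 0 (· == some (some true))
    (.pop 0 ;; .move 0 1) (.pop 0 ;; .pop 0 ;; .push 1 none)) ;; .pop 0 ;; moveAll 1 0

theorem writeOutput_run (w : List Sym) :
    MRun writeOutput (tk (w.map symPair)) w (9 * w.length + 3) := by
  have key : ∀ w a : List Sym, Run (.loop 0 (· == some none) (.pop 0 ;; .pop 0 ;;
      .ite 0 (· == some (some true)) (.pop 0 ;; .move 0 1) (.pop 0 ;; .pop 0 ;; .push 1 none)))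
      (st (tk (w.map symPair)) a [] []) (st [some false] (w.reverse ++ a) [] [])
      (7 * w.length + 1) := by
    intro w
    induction w with
    | nil => intro a; exact .loop_done rfl
    | cons x w ih =>
      intro a
      have h := ih (x :: a)
      cases x with
      | none =>
        refine .mono (.loop_step rfl (.seq (.pop 0 _) (.seq (.pop 0 _) (.ite_false rfl
          (.seq (.pop 0 _) (.seq (.pop 0 _) (.push 1 _ _)))))) (t' := 7 * w.length + 1) ?_)
          (by simp; omega)
        simpa [symPair] using h
      | some b =>
        refine .mono (.loop_step rfl (.seq (.pop 0 _) (.seq (.pop 0 _) (.ite_true rfl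
          (.seq (.pop 0 _) (.move 0 1 _))))) (t' := 7 * w.length + 1) ?_)
          (by simp; omega)
        simpa [symPair] using h
  refine .mono (.seq (key w []) (.seq (.pop 0 _) (t' := 2 * w.length + 1) ?_)) (by omega)
  simpa using moveAll_one_zero_run [] w.reverse []

/-- The length of the input word plus the unary size of its first number. -/
def inputSize (l : List ℕ) : ℕ := (encodeNats l).length + l.headI

theorem size_map_symPair (w : List Sym) : size (w.map symPair) = 4 * w.length + 1 := by
  induction w with
  | nil => rfl
  | cons x w ih => simp [ih]; omega

/-- The stages are reading, expansion of the number of states, computation and writing. The bounds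
of the later stages are expressed through `inputSize` by bounding each intermediate value. -/
theorem exists_program (a b : ℕ) : ∃ (c : Cmd) (p : Polynomial ℕ), ∀ (l : List ℕ) (w : List Sym),
    w.map symPair = outputOf a b (unary l.headI, l) →
    MRun c (encodeNats l) w (p.eval (inputSize l)) := by
  obtain ⟨c₁, p₁, h₁⟩ := PolyTime.readNats
  obtain ⟨c₂, p₂, h₂⟩ := exists_unary_program
  have hout := (PolyTime.outputOf a b).size_bd
  obtain ⟨c₃, p₃, h₃⟩ := PolyTime.outputOf a b
  obtain ⟨q, hq⟩ := hout
  obtain ⟨r, hr⟩ := PolyTime.readNats.size_bd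
  have hw : PolyBd inputSize fun l => 4 * inputSize l + 1 :=
    ((PolyBd.const 4).mul .self).add (.const 1)
  have hz : PolyBd inputSize fun l => r.eval (4 * inputSize l + 1) + 2 * inputSize l + 2 :=
    ((hw.eval r).add ((PolyBd.const 2).mul .self)).add (.const 2)
  obtain ⟨P, hP⟩ := (((PolyBd.const 9).mul .self).add (.const 4) : PolyBd inputSize _).add
    ((hw.eval p₁).add ((hz.eval p₂).add ((hz.eval p₃).add
      (((PolyBd.const 9).mul (hz.eval q)).add (.const 3)))))
  refine ⟨readInput ;; c₁ ;; c₂ ;; c₃ ;; writeOutput, P, fun l w hlw => .mono ?_ (hP l)⟩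
  have hlen : (encodeNats l).length ≤ inputSize l := Nat.le_add_right _ _
  have hhead : l.headI ≤ inputSize l := Nat.le_add_left _ _
  have hsize : size ((encodeNats l).map symPair) ≤ 4 * inputSize l + 1 := by
    rw [size_map_symPair]; omega
  have hl : size l ≤ r.eval (4 * inputSize l + 1) := by
    have := hr ((encodeNats l).map symPair)
    dsimp only at this
    rw [readNats_encodeNats] at this
    exact this.trans (eval_mono r hsize)
  have hzl : size (unary l.headI, l) ≤ r.eval (4 * inputSize l + 1) + 2 * inputSize l + 2 := by
    rw [size_prod, size_unary]
    dsimp only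
    omega
  have hwl : w.length ≤ q.eval (r.eval (4 * inputSize l + 1) + 2 * inputSize l + 2) := by
    have h1 := (hq (unary l.headI, l)).trans (eval_mono q hzl)
    dsimp only at h1
    rw [← hlw, size_map_symPair] at h1
    omega
  have r₁ := h₁ ((encodeNats l).map symPair) []
  rw [readNats_encodeNats, List.append_nil, List.append_nil] at r₁
  have r₂ := h₂ l []
  rw [List.append_nil, List.append_nil] at r₂
  have r₃ := h₃ (unary l.headI, l) []
  rw [List.append_nil, List.append_nil, ← hlw] at r₃
  exact .seq ((readInput_run _).mono (by omega)) (.seq (r₁.mono (eval_mono p₁ hsize))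
    (.seq (r₂.mono (eval_mono p₂ (by omega))) (.seq (r₃.mono (eval_mono p₃ hzl))
    ((writeOutput_run w).mono (by omega)))))

/-! ### The length of the input word is polynomial in the size of the system. -/

/-- The total size of the membership degrees of a fuzzy set that are not zero. -/
def weight {n : ℕ} (μ : Fin n → Degree) : ℕ := ∑ x with (μ x).num ≠ 0, (μ x).bits

theorem num_eq_zero_of_weight {n : ℕ} {μ : Fin n → Degree} (h : weight μ = 0) (x : Fin n) :
    (μ x).num = 0 := by
  by_contra hx
  have := (Finset.sum_eq_zero_iff.1 h) x (by simpa using hx)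
  have h2 : 0 < Nat.size (μ x).num := Nat.size_pos.2 (Nat.pos_of_ne_zero hx)
  unfold Degree.bits at this
  omega

theorem val_eq_of_weight {n : ℕ} {μ η : Fin n → Degree} (h : weight μ = 0) (h' : weight η = 0) :
    (fun x => (μ x).val) = fun x => (η x).val := by
  funext x
  simp [Degree.val, num_eq_zero_of_weight h x, num_eq_zero_of_weight h' x]

/-- Only the zero fuzzy set has weight `0`, and in a list without repetition it occurs at most once.
This is where the absence of repetitions matters. -/
theorem length_le_sum_weight {n : ℕ} {Y : List (Fin n → Degree)}
    (h : (Y.map fun μ x => (μ x).val).Nodup) : Y.length ≤ (Y.map weight).sum + 1 := by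
  induction Y with
  | nil => simp
  | cons μ Y ih =>
    rw [List.map_cons, List.nodup_cons] at h
    have h1 := ih h.2
    rw [List.length_cons, List.map_cons, List.sum_cons]
    rcases Nat.eq_zero_or_pos (weight μ) with h0 | h0
    · have : ∀ Y : List (Fin n → Degree), (∀ η ∈ Y, 1 ≤ weight η) →
          Y.length ≤ (Y.map weight).sum := by
        intro Y
        induction Y with
        | nil => simp
        | cons η Y ih =>
          intro hY
          have h2 := hY η List.mem_cons_self
          have h3 := ih fun ν hν => hY ν (List.mem_cons_of_mem _ hν)
          rw [List.length_cons, List.map_cons, List.sum_cons]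
          omega
      have := this Y fun η hη => by
        by_contra h2
        refine h.1 (List.mem_map.2 ⟨η, hη, val_eq_of_weight (by omega) h0⟩)
      omega
    · omega

theorem size_eq (M : RationalFTS) :
    M.size = M.n + M.k + ∑ s, ∑ a, ((M.trans s a).map weight).sum := rfl

theorem sum_weight_le (M : RationalFTS) (s : Fin M.n) (a : Fin M.k) :
    ((M.trans s a).map weight).sum ≤ M.size := by
  rw [size_eq]
  refine le_trans ?_ (Nat.le_add_left _ _)
  refine le_trans ?_ (Finset.single_le_sum (fun _ _ => Nat.zero_le _) (Finset.mem_univ s))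
  exact Finset.single_le_sum (f := fun a => ((M.trans s a).map weight).sum)
    (fun _ _ => Nat.zero_le _) (Finset.mem_univ a)

/-- Zero degrees are not counted in `M.size`, but `0/1` has a single binary digit; hence the `+ 1`.
-/
theorem bits_le (M : RationalFTS) {s : Fin M.n} {a : Fin M.k} {μ : Fin M.n → Degree}
    (hμ : μ ∈ M.trans s a) (x : Fin M.n) : (μ x).bits ≤ M.size + 1 := by
  by_cases hx : (μ x).num = 0
  · have := (μ x).den_of_num_eq_zero hx
    rw [Degree.bits, hx, this, Nat.size_zero, Nat.size_one]
    omega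
  · have h1 : (μ x).bits ≤ weight μ := Finset.single_le_sum (f := fun x => (μ x).bits)
      (fun _ _ => Nat.zero_le _) (by simpa using hx)
    have h2 : weight μ ≤ ((M.trans s a).map weight).sum :=
      List.single_le_sum (fun _ _ => Nat.zero_le _) _ (List.mem_map_of_mem hμ)
    have := sum_weight_le M s a
    omega

theorem length_encodeNats_cons (m : ℕ) (l : List ℕ) :
    (encodeNats (m :: l)).length = Nat.size m + 1 + (encodeNats l).length := by
  simp [encodeNats, Nat.size_eq_bits_len]
  omega

theorem length_encodeNats_flatMap_le {β : Type} (l : List β) (f : β → List ℕ) (B : ℕ)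
    (h : ∀ x ∈ l, (encodeNats (f x)).length ≤ B) :
    (encodeNats (l.flatMap f)).length ≤ l.length * B := by
  induction l with
  | nil => simp [encodeNats]
  | cons x l ih =>
    have h1 := h x List.mem_cons_self
    have h2 := ih fun y hy => h y (List.mem_cons_of_mem _ hy)
    rw [encodeNats, List.flatMap_cons, List.flatMap_append, List.length_append, List.length_cons,
      Nat.succ_mul]
    rw [encodeNats] at h1 h2
    omega

theorem size_le_self (n : ℕ) : Nat.size n ≤ n := Nat.size_le.2 Nat.lt_two_pow_self

theorem inputSize_numsOf_le (M : RationalFTS) : inputSize (numsOf M) ≤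
    3 * M.size + 2 + M.size * (M.size * (M.size + 2 + (M.size + 1) * (M.size * (M.size + 3)))) := by
  have hn : M.n ≤ M.size := by rw [size_eq]; omega
  have hk : M.k ≤ M.size := by rw [size_eq]; omega
  have h1 : ∀ s a, ∀ μ ∈ M.trans s a, (encodeNats ((List.finRange M.n).flatMap fun x =>
      [(μ x).num, (μ x).den])).length ≤ M.size * (M.size + 3) := by
    intro s a μ hμ
    refine (length_encodeNats_flatMap_le _ _ (M.size + 3) fun x _ => ?_).trans ?_
    · have := bits_le M hμ x
      rw [length_encodeNats_cons, length_encodeNats_cons]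
      simp only [encodeNats, List.flatMap_nil, List.length_nil]
      unfold Degree.bits at this
      omega
    · rw [List.length_finRange]
      exact Nat.mul_le_mul_right _ hn
  have h2 : ∀ s a, (encodeNats ((M.trans s a).length :: (M.trans s a).flatMap fun μ =>
      (List.finRange M.n).flatMap fun x => [(μ x).num, (μ x).den])).length ≤
      M.size + 2 + (M.size + 1) * (M.size * (M.size + 3)) := by
    intro s a
    have h3 := length_le_sum_weight (M.nodup s a)
    have h4 := sum_weight_le M s a
    rw [length_encodeNats_cons]
    have h5 := size_le_self (M.trans s a).length
    have h6 := (length_encodeNats_flatMap_le _ _ _ (h1 s a)).trans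
      (Nat.mul_le_mul_right (M.size * (M.size + 3)) (show _ ≤ M.size + 1 by omega))
    omega
  have h3 := length_encodeNats_flatMap_le (List.finRange M.n)
    (fun s => (List.finRange M.k).flatMap fun a => (M.trans s a).length ::
      (M.trans s a).flatMap fun μ => (List.finRange M.n).flatMap fun x => [(μ x).num, (μ x).den])
    (M.size * (M.size + 2 + (M.size + 1) * (M.size * (M.size + 3)))) fun s _ => by
      refine (length_encodeNats_flatMap_le _ _ _ fun a _ => h2 s a).trans ?_
      rw [List.length_finRange]
      exact Nat.mul_le_mul_right _ hk
  rw [List.length_finRange] at h3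
  replace h3 := h3.trans (Nat.mul_le_mul_right _ hn)
  have h4 := size_le_self M.n
  have h5 := size_le_self M.k
  have h6 : M.n + M.k ≤ M.size := by rw [size_eq]; omega
  rw [inputSize, numsOf, length_encodeNats_cons, length_encodeNats_cons, List.headI_cons]
  omega

theorem polyBd_inputSize_numsOf : PolyBd RationalFTS.size fun M => inputSize (numsOf M) := by
  have h : PolyBd RationalFTS.size RationalFTS.size := .self
  exact ((((PolyBd.const 3).mul h).add (.const 2)).add (h.mul (h.mul ((h.add (.const 2)).add
    ((h.add (.const 1)).mul (h.mul (h.add (.const 3)))))))).of_le inputSize_numsOf_le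

end StackProgram

/-! ### Sublevel sets of the lifted distance. -/

namespace FuzzyTransition

open Filter Topology

theorem exists_gt_forall_le {ι : Type} [Finite ι] (f : ι → ℝ) (v : ℝ) :
    ∃ m > v, ∀ i, v < f i → m ≤ f i := by
  have h : ∀ᶠ m in 𝓝[>] v, ∀ i, v < f i → m ≤ f i := by
    refine eventually_all.2 fun i => ?_
    by_cases hi : v < f i
    · filter_upwards [Ioc_mem_nhdsGT hi] with m hm _ using hm.2
    · exact Eventually.of_forall fun _ h => (hi h).elim
  have h1 : ∀ᶠ m in 𝓝[>] v, m ∈ Set.Ioi v := self_mem_nhdsWithin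
  obtain ⟨m, hm, h⟩ := (h1.and h).exists
  exact ⟨m, hm, h⟩

theorem exists_lt_forall_ge {ι : Type} [Finite ι] (f : ι → ℝ) {l u : ℝ} (hlu : l < u) :
    ∃ v, l ≤ v ∧ v < u ∧ ∀ i, f i < u → f i ≤ v := by
  have h : ∀ᶠ m in 𝓝[<] u, ∀ i, f i < u → f i ≤ m := by
    refine eventually_all.2 fun i => ?_
    by_cases hi : f i < u
    · filter_upwards [Ico_mem_nhdsLT hi] with m hm _ using hm.1
    · exact Eventually.of_forall fun _ h => (hi h).elim
  have h1 : ∀ᶠ m in 𝓝[<] u, m ∈ Set.Ico l u := Ico_mem_nhdsLT hlu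
  obtain ⟨m, hm, h⟩ := (h1.and h).exists
  exact ⟨m, hm.1, hm.2, h⟩

theorem exists_eq_iSup {ι : Type} [Finite ι] [Nonempty ι] (f : ι → ℝ) : ∃ i, f i = ⨆ j, f j :=
  exists_eq_ciSup_of_finite

theorem le_iSup_real {ι : Type} [Finite ι] (f : ι → ℝ) (i : ι) : f i ≤ ⨆ j, f j :=
  le_ciSup (Set.finite_range f).bddAbove i

theorem iSup_le_iff_of_nonneg {ι : Type} [Finite ι] (f : ι → ℝ) {v : ℝ} (hv : 0 ≤ v) :
    ⨆ j, f j ≤ v ↔ ∀ j, f j ≤ v :=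
  ⟨fun h j => (le_iSup_real f j).trans h, fun h => Real.iSup_le h hv⟩

section lift

variable {S : Type}

/-- Every degree of `μ` above `v` is matched by a degree of `η` at a distance of at most `v`. -/
def Covers (d : S → S → ℝ) (v : ℝ) (μ η : S → ℝ) : Prop :=
  ∀ s, μ s ≤ v ∨ ∃ t, μ s ≤ η t ∧ d s t ≤ v

/-- The condition that the lifted distance is at most `v < 1`. -/
def LiftRel (d : S → S → ℝ) (v : ℝ) (μ η : S → ℝ) : Prop :=
  (⨆ s, μ s) = (⨆ s, η s) ∧ Covers d v μ η ∧ Covers d v η μ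

variable [Finite S] {d : S → S → ℝ} {μ η : S → ℝ} {v : ℝ}

theorem covers_of_one_le (hμ : ∀ s, μ s ∈ Set.Icc (0 : ℝ) 1) (hv : 1 ≤ v) : Covers d v μ η :=
  fun s => Or.inl ((hμ s).2.trans hv)

/-- The values of the couplings of `μ` and `η`. -/
def couplingValues (d : S → S → ℝ) (μ η : S → ℝ) : Set ℝ :=
  {v : ℝ | ∃ x : S → S → ℝ,
    (∀ s, ⨆ t, x s t = μ s) ∧ (∀ t, ⨆ s, x s t = η t) ∧ (∀ s t, 0 ≤ x s t) ∧
      v = ⨆ p : S × S, min (d p.1 p.2) (x p.1 p.2)}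

theorem bddBelow_couplingValues (hd : IsPseudoUltrametric d) :
    BddBelow (couplingValues d μ η) := by
  refine ⟨0, ?_⟩
  rintro _ ⟨x, -, -, hx, rfl⟩
  exact Real.iSup_nonneg fun p => le_min (hd.mem_Icc _ _).1 (hx _ _)

/-- Take the largest candidate, `min (μ s) (η t)`, cut off at `v` where `d s t > v`. Degrees above
`v` are attained at their matching partner; degrees up to `v` are attained at a maximiser of the
other fuzzy set, by equality of heights. -/
theorem exists_coupling_le (hd : IsPseudoUltrametric d) (hμ : ∀ s, 0 ≤ μ s) (hη : ∀ s, 0 ≤ η s)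
    (hv : 0 ≤ v) (h : LiftRel d v μ η) : ∃ w ∈ couplingValues d μ η, w ≤ v := by
  classical
  obtain ⟨hsup, h1, h2⟩ := h
  let x : S → S → ℝ := fun s t => if d s t ≤ v then min (μ s) (η t) else min (min (μ s) (η t)) v
  have hxμ : ∀ s t, x s t ≤ μ s := by
    intro s t
    simp only [x]
    split_ifs
    · exact min_le_left _ _
    · exact (min_le_left _ _).trans (min_le_left _ _)
  have hxη : ∀ s t, x s t ≤ η t := by
    intro s t
    simp only [x]
    split_ifs
    · exact min_le_right _ _
    · exact (min_le_left _ _).trans (min_le_right _ _)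
  have hx0 : ∀ s t, 0 ≤ x s t := by
    intro s t
    simp only [x]
    split_ifs
    · exact le_min (hμ s) (hη t)
    · exact le_min (le_min (hμ s) (hη t)) hv
  refine ⟨_, ⟨x, fun s => ?_, fun t => ?_, hx0, rfl⟩, Real.iSup_le (fun p => ?_) hv⟩
  · refine le_antisymm (Real.iSup_le (hxμ s) (hμ s)) ?_
    have : ∃ t, μ s ≤ x s t := by
      rcases h1 s with h | ⟨t, ht, hdt⟩
      · have : Nonempty S := ⟨s⟩
        obtain ⟨t, ht⟩ := exists_eq_iSup η
        have hst : μ s ≤ η t := by rw [ht, ← hsup]; exact le_iSup_real μ s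
        refine ⟨t, ?_⟩
        simp only [x]
        split_ifs
        · exact le_min le_rfl hst
        · exact le_min (le_min le_rfl hst) h
      · exact ⟨t, by simp [x, hdt, ht]⟩
    obtain ⟨t, ht⟩ := this
    exact ht.trans (le_iSup_real (x s) t)
  · refine le_antisymm (Real.iSup_le (fun s => hxη s t) (hη t)) ?_
    have : ∃ s, η t ≤ x s t := by
      rcases h2 t with h | ⟨s, hs, hds⟩
      · have : Nonempty S := ⟨t⟩
        obtain ⟨s, hs⟩ := exists_eq_iSup μ
        have hst : η t ≤ μ s := by rw [hs, hsup]; exact le_iSup_real η t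
        refine ⟨s, ?_⟩
        simp only [x]
        split_ifs
        · exact le_min hst le_rfl
        · exact le_min (le_min hst le_rfl) h
      · rw [hd.symm] at hds
        exact ⟨s, by simp [x, hds, hs]⟩
    obtain ⟨s, hs⟩ := this
    exact hs.trans (le_iSup_real (fun s => x s t) s)
  · by_cases h : d p.1 p.2 ≤ v
    · exact (min_le_left _ _).trans h
    · refine (min_le_right _ _).trans ?_
      simp only [x, h, if_false]
      exact min_le_right _ _

theorem covers_of_forall_coupling {x : S → S → ℝ} (h1 : ∀ s, ⨆ t, x s t = μ s)
    (h2 : ∀ t, ⨆ s, x s t = η t) (s : S) :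
    ∃ t, μ s ≤ η t ∧ min (d s t) (μ s) ≤ ⨆ p : S × S, min (d p.1 p.2) (x p.1 p.2) := by
  have : Nonempty S := ⟨s⟩
  obtain ⟨t, ht⟩ := exists_eq_iSup (x s)
  rw [h1] at ht
  refine ⟨t, ?_, ?_⟩
  · rw [← ht, ← h2]
    exact le_iSup_real (fun s => x s t) s
  · rw [← ht]
    exact le_iSup_real (fun p : S × S => min (d p.1 p.2) (x p.1 p.2)) (s, t)

/-- If `μ s > v` had no partner, every coupling would route the degree `μ s` through some `t` with
`d s t > v`. As `S` is finite, these distances are at least some `m > v`, so all coupling values are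
at least `min m (μ s) > v`. The gap avoids having to show first that the infimum is attained. -/
theorem covers_of_sInf_le (hne : (couplingValues d μ η).Nonempty)
    (h : sInf (couplingValues d μ η) ≤ v) : Covers d v μ η := by
  by_contra hc
  simp only [Covers, not_forall, not_or, not_exists, not_and, not_le] at hc
  obtain ⟨s, hs, hst⟩ := hc
  obtain ⟨m, hm, hmt⟩ := exists_gt_forall_le (d s) v
  have : min m (μ s) ≤ sInf (couplingValues d μ η) := by
    refine le_csInf hne ?_
    rintro _ ⟨x, hx1, hx2, -, rfl⟩
    obtain ⟨t, ht1, ht2⟩ := covers_of_forall_coupling (d := d) hx1 hx2 s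
    exact (min_le_min_right _ (hmt t (hst t ht1))).trans ht2
  exact absurd (this.trans h) (not_le.2 (lt_min hm hs))

theorem couplingValues_swap (hd : IsPseudoUltrametric d) :
    couplingValues d μ η = couplingValues d η μ := by
  have : ∀ μ η, couplingValues d μ η ⊆ couplingValues d η μ := by
    rintro μ η _ ⟨x, h1, h2, h3, rfl⟩
    refine ⟨fun s t => x t s, h2, h1, fun s t => h3 t s, ?_⟩
    rw [← (Equiv.prodComm S S).iSup_comp]
    refine iSup_congr fun p => ?_
    simp [hd.symm p.1 p.2]
  exact (this _ _).antisymm (this _ _)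

/-- The alternative `1 ≤ v` is needed for different heights, where the distance is `1` without any
coupling. -/
theorem lift_le_iff (hd : IsPseudoUltrametric d) (hμ : ∀ s, μ s ∈ Set.Icc (0 : ℝ) 1)
    (hη : ∀ s, η s ∈ Set.Icc (0 : ℝ) 1) (hv : 0 ≤ v) :
    lift d μ η ≤ v ↔ 1 ≤ v ∨ LiftRel d v μ η := by
  unfold lift
  split_ifs with hs
  · exact ⟨Or.inl, fun h => h.resolve_right fun h => hs h.1⟩
  · rw [not_not] at hs
    have h1 : ∀ v, 1 ≤ v → LiftRel d v μ η := fun v hv =>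
      ⟨hs, covers_of_one_le hμ hv, covers_of_one_le hη hv⟩
    have hex := fun v hv => exists_coupling_le (v := v) hd (fun s => (hμ s).1) (fun s => (hη s).1) hv
    change sInf (couplingValues d μ η) ≤ v ↔ _
    constructor
    · intro h
      obtain ⟨w, hw, -⟩ := hex 1 zero_le_one (h1 1 le_rfl)
      refine Or.inr ⟨hs, covers_of_sInf_le ⟨w, hw⟩ h, ?_⟩
      rw [couplingValues_swap hd] at h hw
      exact covers_of_sInf_le ⟨w, hw⟩ h
    · intro h
      obtain ⟨w, hw, hwv⟩ := hex v hv (h.elim (h1 v) id)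
      exact (csInf_le (bddBelow_couplingValues hd) hw).trans hwv

theorem lift_nonneg (hd : IsPseudoUltrametric d) : 0 ≤ lift d μ η := by
  unfold lift
  split_ifs
  · exact zero_le_one
  · refine Real.sInf_nonneg ?_
    rintro _ ⟨x, -, -, hx, rfl⟩
    exact Real.iSup_nonneg fun p => le_min (hd.mem_Icc _ _).1 (hx _ _)

theorem LiftRel.self (hd : IsPseudoUltrametric d) (hv : 0 ≤ v) : LiftRel d v μ μ := by
  have : Covers d v μ μ := fun s => Or.inr ⟨s, le_rfl, (hd.self s).le.trans hv⟩
  exact ⟨rfl, this, this⟩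

theorem Covers.trans (hd : IsPseudoUltrametric d) {ν : S → ℝ} (h : Covers d v μ η)
    (h' : Covers d v η ν) : Covers d v μ ν := by
  intro s
  rcases h s with h1 | ⟨t, h1, h2⟩
  · exact Or.inl h1
  · rcases h' t with h3 | ⟨r, h3, h4⟩
    · exact Or.inl (h1.trans h3)
    · exact Or.inr ⟨r, h1.trans h3, (hd.ultra _ _ _).trans (max_le h2 h4)⟩

theorem LiftRel.trans (hd : IsPseudoUltrametric d) {ν : S → ℝ} (h : LiftRel d v μ η)
    (h' : LiftRel d v η ν) : LiftRel d v μ ν :=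
  ⟨h.1.trans h'.1, h.2.1.trans hd h'.2.1, h'.2.2.trans hd h.2.2⟩

theorem LiftRel.mono {d' : S → S → ℝ} (hdd : ∀ s t, d s t ≤ v → d' s t ≤ v)
    (h : LiftRel d v μ η) : LiftRel d' v μ η :=
  ⟨h.1, fun s => (h.2.1 s).imp_right fun ⟨t, h1, h2⟩ => ⟨t, h1, hdd _ _ h2⟩,
    fun s => (h.2.2 s).imp_right fun ⟨t, h1, h2⟩ => ⟨t, h1, hdd _ _ h2⟩⟩

end lift

/-! ### Sublevel sets of the Hausdorff distance. -/

section hausdorff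

variable {X : Type} {D : X → X → ℝ} {Y Z : Set X} {v : ℝ}

theorem distToSet_le_iff (hZ : Z.Finite) {x : X} (hD : ∀ z ∈ Z, D x z ≤ 1) :
    distToSet D x Z ≤ v ↔ 1 ≤ v ∨ ∃ z ∈ Z, D x z ≤ v := by
  unfold distToSet
  split_ifs with h
  · have := hZ.to_subtype
    have := h.to_subtype
    obtain ⟨z, hz⟩ := exists_eq_ciInf_of_finite (f := fun z : Z => D x z)
    rw [← hz]
    refine ⟨fun h => Or.inr ⟨z, z.2, h⟩, ?_⟩
    rintro (h | ⟨z', hz', h⟩)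
    · exact (hD z z.2).trans h
    · rw [hz]
      exact (ciInf_le (Set.finite_range _).bddBelow (⟨z', hz'⟩ : Z)).trans h
  · refine ⟨Or.inl, ?_⟩
    rintro (h' | ⟨z, hz, -⟩)
    · exact h'
    · exact (h ⟨z, hz⟩).elim

theorem distToSet_nonneg (hD : ∀ x y, 0 ≤ D x y) (x : X) : 0 ≤ distToSet D x Z := by
  unfold distToSet
  split_ifs
  · exact Real.iInf_nonneg fun z => hD _ _
  · exact zero_le_one

theorem hausdorff_le_iff (hY : Y.Finite) (hZ : Z.Finite) (hD : ∀ y ∈ Y, ∀ z ∈ Z, D y z ≤ 1)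
    (hD' : ∀ z ∈ Z, ∀ y ∈ Y, D z y ≤ 1) (hv : 0 ≤ v) :
    hausdorff D Y Z ≤ v ↔ 1 ≤ v ∨
      (∀ y ∈ Y, ∃ z ∈ Z, D y z ≤ v) ∧ ∀ z ∈ Z, ∃ y ∈ Y, D z y ≤ v := by
  unfold hausdorff
  split_ifs with h
  · obtain ⟨rfl, rfl⟩ := h
    simpa using hv
  · have := hY.to_subtype
    have := hZ.to_subtype
    rw [max_le_iff, iSup_le_iff_of_nonneg _ hv, iSup_le_iff_of_nonneg _ hv]
    by_cases h1 : 1 ≤ v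
    · simp only [h1, true_or, iff_true]
      exact ⟨fun y => (distToSet_le_iff hZ (hD y y.2)).2 (Or.inl h1),
        fun z => (distToSet_le_iff hY (hD' z z.2)).2 (Or.inl h1)⟩
    · simp only [h1, false_or, Subtype.forall]
      refine and_congr (forall₂_congr fun y hy => ?_) (forall₂_congr fun z hz => ?_)
      · rw [distToSet_le_iff hZ (hD y hy)]
        simp [h1]
      · rw [distToSet_le_iff hY (hD' z hz)]
        simp [h1]

theorem hausdorff_nonneg (hD : ∀ x y, 0 ≤ D x y) : 0 ≤ hausdorff D Y Z := by
  unfold hausdorff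
  split_ifs
  · exact le_rfl
  · exact le_max_of_le_left (Real.iSup_nonneg fun y => distToSet_nonneg hD _)

end hausdorff

/-! ### The functional `Δ`: threshold description, monotonicity and ultrametricity. -/

section functional

variable {S A : Type} [Finite S] [Finite A] {M : FTS S A} {γ v : ℝ} {d : S → S → ℝ}

/-- The condition that the Hausdorff distance of the lifted distance is at most `v < 1`. -/
def HausRel (d : S → S → ℝ) (v : ℝ) (Y Z : Set (S → ℝ)) : Prop :=
  (∀ μ ∈ Y, ∃ η ∈ Z, LiftRel d v μ η) ∧ ∀ η ∈ Z, ∃ μ ∈ Y, LiftRel d v η μ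

theorem functional_le_iff (hM : ∀ s a, (M.δ s a).Finite) (hd : IsPseudoUltrametric d) (hγ : 0 < γ)
    (hv : 0 ≤ v) (s t : S) :
    functional M γ d s t ≤ γ * v ↔ 1 ≤ v ∨ ∀ a, HausRel d v (M.δ s a) (M.δ t a) := by
  have h1 : ∀ s t a, ∀ μ ∈ M.δ s a, ∀ η ∈ M.δ t a, ∀ v, 0 ≤ v →
      (lift d μ η ≤ v ↔ 1 ≤ v ∨ LiftRel d v μ η) := fun s t a μ hμ η hη v hv =>
    lift_le_iff hd (M.degree_mem s a μ hμ) (M.degree_mem t a η hη) hv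
  have h2 : ∀ s t a, ∀ μ ∈ M.δ s a, ∀ η ∈ M.δ t a, lift d μ η ≤ 1 := fun s t a μ hμ η hη =>
    (h1 s t a μ hμ η hη 1 zero_le_one).2 (Or.inl le_rfl)
  rw [functional, mul_le_mul_iff_right₀ hγ, iSup_le_iff_of_nonneg _ hv]
  have h3 : ∀ a, hausdorff (lift d) (M.δ s a) (M.δ t a) ≤ v ↔
      1 ≤ v ∨ HausRel d v (M.δ s a) (M.δ t a) := by
    intro a
    rw [hausdorff_le_iff (hM s a) (hM t a) (h2 s t a) (h2 t s a) hv]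
    by_cases hv1 : 1 ≤ v
    · simp [hv1]
    · simp only [hv1, false_or, HausRel]
      refine and_congr (forall₂_congr fun μ hμ => exists_congr fun η => and_congr_right fun hη => ?_)
        (forall₂_congr fun μ hμ => exists_congr fun η => and_congr_right fun hη => ?_)
      · rw [h1 s t a μ hμ η hη v hv]
        simp [hv1]
      · rw [h1 t s a μ hμ η hη v hv]
        simp [hv1]
  simp only [h3]
  by_cases hv1 : 1 ≤ v <;> simp [hv1]

theorem functional_nonneg (hd : IsPseudoUltrametric d) (hγ : 0 < γ) (s t : S) :
    0 ≤ functional M γ d s t :=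
  mul_nonneg hγ.le (Real.iSup_nonneg fun _ => hausdorff_nonneg fun _ _ => lift_nonneg hd)

theorem functional_le (hM : ∀ s a, (M.δ s a).Finite) (hd : IsPseudoUltrametric d) (hγ : 0 < γ)
    (s t : S) : functional M γ d s t ≤ γ := by
  simpa using (functional_le_iff hM hd hγ zero_le_one s t).2 (Or.inl le_rfl)

/-- If the sublevel sets of `d` at height `v` are contained in those of `d'`, then the sublevel set of
`Δ d` at height `γ v` is contained in that of `Δ d'`. -/
theorem functional_threshold (hM : ∀ s a, (M.δ s a).Finite) (hd : IsPseudoUltrametric d)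
    {d' : S → S → ℝ} (hd' : IsPseudoUltrametric d') (hγ : 0 < γ) (hv : 0 ≤ v)
    (hdd : ∀ s t, d s t ≤ v → d' s t ≤ v) {s t : S} (h : functional M γ d s t ≤ γ * v) :
    functional M γ d' s t ≤ γ * v := by
  rw [functional_le_iff hM hd hγ hv] at h
  rw [functional_le_iff hM hd' hγ hv]
  refine h.imp_right fun h a => ⟨fun μ hμ => ?_, fun η hη => ?_⟩
  · obtain ⟨η, hη, h1⟩ := (h a).1 μ hμ
    exact ⟨η, hη, h1.mono hdd⟩
  · obtain ⟨μ, hμ, h1⟩ := (h a).2 η hη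
    exact ⟨μ, hμ, h1.mono hdd⟩

/-- Sublevel sets of `d'` lie in those of `d`; apply the threshold principle at `v = Δ d' / γ`. -/
theorem functional_mono (hM : ∀ s a, (M.δ s a).Finite) (hd : IsPseudoUltrametric d)
    {d' : S → S → ℝ} (hd' : IsPseudoUltrametric d') (hγ : 0 < γ) (h : ∀ s t, d s t ≤ d' s t)
    (s t : S) : functional M γ d s t ≤ functional M γ d' s t := by
  have h1 : functional M γ d' s t ≤ γ * (functional M γ d' s t / γ) := by
    rw [mul_div_cancel₀ _ hγ.ne']
  have h2 := functional_threshold hM hd' hd hγ (div_nonneg (functional_nonneg hd' hγ s t) hγ.le)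
    (fun s t hst => (h s t).trans hst) h1
  rwa [mul_div_cancel₀ _ hγ.ne'] at h2

theorem isPseudoUltrametric_functional (hM : ∀ s a, (M.δ s a).Finite)
    (hd : IsPseudoUltrametric d) (hγ : 0 < γ) (hγ1 : γ ≤ 1) :
    IsPseudoUltrametric (functional M γ d) := by
  have hsymm : ∀ v, 0 ≤ v → ∀ s t, functional M γ d s t ≤ γ * v → functional M γ d t s ≤ γ * v := by
    intro v hv s t h
    rw [functional_le_iff hM hd hγ hv] at h ⊢
    exact h.imp_right fun h a => ⟨(h a).2, (h a).1⟩
  have hscale : ∀ x : ℝ, γ * (x / γ) = x := fun x => mul_div_cancel₀ _ hγ.ne'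
  have hpos : ∀ s t, 0 ≤ functional M γ d s t / γ := fun s t =>
    div_nonneg (functional_nonneg hd hγ s t) hγ.le
  have hsymm' : ∀ s t, functional M γ d t s ≤ functional M γ d s t := fun s t => by
    have := hsymm _ (hpos s t) s t (hscale _).ge
    rwa [hscale] at this
  refine ⟨fun s t => ⟨functional_nonneg hd hγ s t, (functional_le hM hd hγ s t).trans hγ1⟩,
    fun s => ?_, fun s t => le_antisymm (hsymm' _ _) (hsymm' _ _), fun s t r => ?_⟩
  · refine le_antisymm ?_ (functional_nonneg hd hγ s s)
    have := (functional_le_iff (v := 0) hM hd hγ le_rfl s s).2 (Or.inr fun a =>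
      ⟨fun μ hμ => ⟨μ, hμ, .self hd le_rfl⟩, fun μ hμ => ⟨μ, hμ, .self hd le_rfl⟩⟩)
    simpa using this
  -- For an ultrametric, `LiftRel` at a fixed height is transitive, so the triangle inequality
  -- amounts to composing two matchings at the common height `w / γ`.
  · set w := max (functional M γ d s t) (functional M γ d t r)
    have hw : 0 ≤ w / γ := div_nonneg (le_max_of_le_left (functional_nonneg hd hγ s t)) hγ.le
    rw [← hscale w, functional_le_iff hM hd hγ hw]
    have h1 := (functional_le_iff hM hd hγ hw s t).1 (by rw [hscale]; exact le_max_left _ _)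
    have h2 := (functional_le_iff hM hd hγ hw t r).1 (by rw [hscale]; exact le_max_right _ _)
    rcases h1 with h1 | h1
    · exact Or.inl h1
    rcases h2 with h2 | h2
    · exact Or.inl h2
    refine Or.inr fun a => ⟨fun μ hμ => ?_, fun μ hμ => ?_⟩
    · obtain ⟨η, hη, h3⟩ := (h1 a).1 μ hμ
      obtain ⟨ν, hν, h4⟩ := (h2 a).1 η hη
      exact ⟨ν, hν, h3.trans hd h4⟩
    · obtain ⟨η, hη, h3⟩ := (h2 a).2 μ hμ
      obtain ⟨ν, hν, h4⟩ := (h1 a).2 η hη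
      exact ⟨ν, hν, h3.trans hd h4⟩

/-! ### Iteration -/

theorem isPseudoUltrametric_zero {X : Type} : IsPseudoUltrametric fun _ _ : X => (0 : ℝ) :=
  ⟨fun _ _ => ⟨le_rfl, zero_le_one⟩, fun _ => rfl, fun _ _ => rfl, fun _ _ _ => by simp⟩

/-- The iterates of `Δ` from `0`. -/
noncomputable def iter (M : FTS S A) (γ : ℝ) (i : ℕ) : S → S → ℝ :=
  (functional M γ)^[i] fun _ _ => 0

theorem iter_succ (M : FTS S A) (γ : ℝ) (i : ℕ) :
    iter M γ (i + 1) = functional M γ (iter M γ i) := Function.iterate_succ_apply' _ _ _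

variable (hM : ∀ s a, (M.δ s a).Finite) (hγ : 0 < γ) (hγ1 : γ < 1)

include hM hγ hγ1

theorem isPseudoUltrametric_iter (i : ℕ) : IsPseudoUltrametric (iter M γ i) := by
  induction i with
  | zero => exact isPseudoUltrametric_zero
  | succ i ih => rw [iter_succ]; exact isPseudoUltrametric_functional hM ih hγ hγ1.le

theorem iter_le_succ (i : ℕ) (s t : S) : iter M γ i s t ≤ iter M γ (i + 1) s t := by
  induction i generalizing s t with
  | zero => exact ((isPseudoUltrametric_iter hM hγ hγ1 1).mem_Icc s t).1
  | succ i ih =>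
    rw [iter_succ, iter_succ _ _ (i + 1)]
    exact functional_mono hM (isPseudoUltrametric_iter hM hγ hγ1 _)
      (isPseudoUltrametric_iter hM hγ hγ1 _) hγ ih s t

/-- If an entry changes in step `i + 1` and then has the value `u`, some entry of at least `u / γ` has
changed in step `i`. -/
theorem exists_change {i : ℕ} {s t : S} (h : iter M γ (i + 1) s t < iter M γ (i + 2) s t) :
    ∃ q : S × S, iter M γ i q.1 q.2 < iter M γ (i + 2) s t / γ ∧
      iter M γ (i + 2) s t / γ ≤ iter M γ (i + 1) q.1 q.2 := by
  by_contra! hc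
  set u := iter M γ (i + 2) s t
  -- Here `v < u / γ` lies above all entries of iterate `i + 1` that are below `u / γ`, and is at
  -- least the old value at `(s, t)` over `γ`. If no entry crosses `u / γ`, the sublevel set at `v`
  -- persists from iterate `i` to `i + 1`, and the threshold principle keeps the new value at `(s,
  -- t)` at most `γ v < u`.
  obtain ⟨v, hv1, hv2, hv3⟩ := exists_lt_forall_ge
    (fun q : S × S => iter M γ (i + 1) q.1 q.2) (div_lt_div_of_pos_right h hγ)
  have hp := isPseudoUltrametric_iter hM hγ hγ1
  have hv0 : 0 ≤ v := (div_nonneg ((hp (i + 1)).mem_Icc s t).1 hγ.le).trans hv1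
  have h1 := functional_threshold (M := M) hM (hp i) (hp (i + 1)) hγ hv0
    (fun s t hst => hv3 (s, t) (hc (s, t) (hst.trans_lt hv2))) (s := s) (t := t) (by
      rw [← iter_succ]
      rwa [div_le_iff₀' hγ] at hv1)
  rw [← iter_succ, ← div_le_iff₀' hγ] at h1
  exact absurd h1 (not_le.2 hv2)

/-- Trace the change back to the first step with `exists_change`, collecting one pair of states per
step. Each earlier change reaches a value larger by a factor of at least `1 / γ`, so the pairs are
distinct. -/
theorem exists_large_entries (i : ℕ) (s t : S) (h : iter M γ i s t < iter M γ (i + 1) s t) :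
    ∃ B : Finset (S × S), B.card = i + 1 ∧
      ∀ q ∈ B, iter M γ (i + 1) s t ≤ iter M γ (i + 1) q.1 q.2 := by
  classical
  induction i generalizing s t with
  | zero => exact ⟨{(s, t)}, by simp, by simp⟩
  | succ i ih =>
    obtain ⟨q, hq1, hq2⟩ := exists_change hM hγ hγ1 h
    obtain ⟨B, hB, hBq⟩ := ih q.1 q.2 (hq1.trans_le hq2)
    have hu : 0 < iter M γ (i + 2) s t :=
      ((isPseudoUltrametric_iter hM hγ hγ1 (i + 1)).mem_Icc s t).1.trans_lt h
    have hu2 : iter M γ (i + 2) s t < iter M γ (i + 2) s t / γ := by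
      rw [lt_div_iff₀ hγ]
      nlinarith
    refine ⟨insert (s, t) B, ?_, ?_⟩
    · rw [Finset.card_insert_of_notMem, hB]
      -- Members of `B` are already at least `u / γ > u` in iterate `i + 1`, whereas the entry at
      -- `(s, t)` is still below `u` there.
      intro hst
      have h1 := hBq _ hst
      dsimp only at h1
      linarith
    · intro r hr
      rcases Finset.mem_insert.1 hr with rfl | hr
      · exact le_rfl
      · have h1 := hBq r hr
        have h2 := iter_le_succ hM hγ hγ1 (i + 1) r.1 r.2
        change iter M γ (i + 2) s t ≤ iter M γ (i + 2) r.1 r.2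
        linarith

/-- A change after `|S|²` iterations would need `|S|² + 1` pairs of states. Leastness holds because
all iterates from `0` stay below every fixed point. -/
theorem isBehaviouralDistance_iter [Fintype S] :
    IsBehaviouralDistance M γ (iter M γ (Fintype.card S * Fintype.card S)) := by
  set N := Fintype.card S * Fintype.card S
  refine ⟨⟨isPseudoUltrametric_iter hM hγ hγ1 N, ?_⟩, ?_⟩
  · rw [← iter_succ]
    funext s t
    refine le_antisymm ?_ (iter_le_succ hM hγ hγ1 N s t)
    by_contra! h
    obtain ⟨B, hB, -⟩ := exists_large_entries hM hγ hγ1 N s t h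
    have := B.card_le_univ
    rw [Fintype.card_prod] at this
    omega
  · rintro e ⟨he, hfix⟩
    have : ∀ i, ∀ s t, iter M γ i s t ≤ e s t := by
      intro i
      induction i with
      | zero => exact fun s t => (he.mem_Icc s t).1
      | succ i ih =>
        intro s t
        rw [iter_succ, ← hfix]
        exact functional_mono hM (isPseudoUltrametric_iter hM hγ hγ1 i) he hγ ih s t
    exact this N

end functional

end FuzzyTransition

/-! ### Correctness of the algorithm on fractions. -/

namespace StackProgram

open FuzzyTransition

/-- The value of a fraction. -/
noncomputable def val (p : Frac) : ℝ := (p.1 : ℝ) / (p.2 : ℝ)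

/-- Fractions in the unit interval with a positive denominator. -/
def Proper (p : Frac) : Prop := 0 < p.2 ∧ p.1 ≤ p.2

theorem proper_zero : Proper (0, 1) := ⟨one_pos, zero_le_one⟩

theorem proper_one : Proper (1, 1) := ⟨one_pos, le_rfl⟩

theorem proper_fracOf (q : Degree) : Proper (fracOf q) := ⟨q.den_pos, q.num_le_den⟩

theorem Proper.scale {a b : ℕ} (hb : 0 < b) (hab : a ≤ b) {p : Frac} (hp : Proper p) :
    Proper (scale a b p) :=
  ⟨Nat.mul_pos hb hp.1, Nat.mul_le_mul hab hp.2⟩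

theorem val_zero : val (0, 1) = 0 := by simp [val]

theorem val_one : val (1, 1) = 1 := by simp [val]

theorem val_nonneg (p : Frac) : 0 ≤ val p := div_nonneg (Nat.cast_nonneg _) (Nat.cast_nonneg _)

theorem val_scale (a b : ℕ) (p : Frac) : val (scale a b p) = (a / b : ℝ) * val p := by
  simp [val, scale, mul_div_mul_comm]

theorem fle_iff {p q : Frac} (hp : Proper p) (hq : Proper q) : fle p q = true ↔ val p ≤ val q := by
  rw [fle, decide_eq_true_iff, val, val,
    div_le_div_iff₀ (by exact_mod_cast hp.1) (by exact_mod_cast hq.1)]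
  exact_mod_cast Iff.rfl

theorem val_fmax {p q : Frac} (hp : Proper p) (hq : Proper q) :
    val (fmax p q) = max (val p) (val q) := by
  have h := fle_iff hp hq
  unfold fmax
  cases hpq : fle p q
  · rw [hpq] at h
    exact (max_eq_left (le_of_not_ge fun h1 => Bool.false_ne_true (h.2 h1))).symm
  · exact (max_eq_right (h.1 hpq)).symm

theorem val_fmin {p q : Frac} (hp : Proper p) (hq : Proper q) :
    val (fmin p q) = min (val p) (val q) := by
  have h := fle_iff hp hq
  unfold fmin
  cases hpq : fle p q
  · rw [hpq] at h
    exact (min_eq_right (le_of_not_ge fun h1 => Bool.false_ne_true (h.2 h1))).symm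
  · exact (min_eq_left (h.1 hpq)).symm

theorem val_maxL_le_iff {l : List Frac} (hl : ∀ p ∈ l, Proper p) {v : ℝ} (hv : 0 ≤ v) :
    val (maxL l) ≤ v ↔ ∀ p ∈ l, val p ≤ v := by
  have key : ∀ b, Proper b → (val (l.foldl fmax b) ≤ v ↔ val b ≤ v ∧ ∀ p ∈ l, val p ≤ v) := by
    induction l with
    | nil => simp
    | cons x l ih =>
      intro b hb
      have hx := hl x List.mem_cons_self
      rw [List.foldl_cons, ih (fun p hp => hl p (List.mem_cons_of_mem _ hp)) _ (fmax_of hb hx),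
        val_fmax hb hx, max_le_iff, List.forall_mem_cons, and_assoc]
  rw [maxL, key _ proper_zero, val_zero]
  exact and_iff_right hv

theorem val_minL_le_iff {l : List Frac} (hl : ∀ p ∈ l, Proper p) {v : ℝ} :
    val (minL l) ≤ v ↔ 1 ≤ v ∨ ∃ p ∈ l, val p ≤ v := by
  have key : ∀ b, Proper b → (val (l.foldl fmin b) ≤ v ↔ val b ≤ v ∨ ∃ p ∈ l, val p ≤ v) := by
    induction l with
    | nil => simp
    | cons x l ih =>
      intro b hb
      have hx := hl x List.mem_cons_self
      rw [List.foldl_cons, ih (fun p hp => hl p (List.mem_cons_of_mem _ hp)) _ (fmin_of hb hx),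
        val_fmin hb hx, min_le_iff, List.exists_mem_cons_iff, or_assoc]
  rw [minL, key _ proper_one, val_one]

/-- Algorithm and functional are compared through their sublevel conditions, which have the same
form on both sides. -/
theorem eq_of_forall_nonneg_iff {x y : ℝ} (hx : 0 ≤ x) (hy : 0 ≤ y)
    (h : ∀ v, 0 ≤ v → (x ≤ v ↔ y ≤ v)) : x = y :=
  le_antisymm ((h y hy).2 le_rfl) ((h x hx).1 le_rfl)

section

variable {n : ℕ}

theorem proper_vecOf (μ : Fin n → Degree) : ∀ p ∈ vecOf μ, Proper p := by
  intro p hp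
  obtain ⟨x, -, rfl⟩ := List.mem_map.1 hp
  exact proper_fracOf _

theorem val_maxL_vecOf (μ : Fin n → Degree) : val (maxL (vecOf μ)) = ⨆ s, (μ s).val := by
  refine eq_of_forall_nonneg_iff (val_nonneg _)
    (Real.iSup_nonneg fun s => (μ s).val_mem_Icc.1) fun v hv => ?_
  rw [val_maxL_le_iff (proper_vecOf μ) hv, iSup_le_iff_of_nonneg _ hv]
  simp [vecOf, val, fracOf, Degree.val]

/-- A matrix of fractions as a list of rows. -/
def matrix (D : Fin n → Fin n → Frac) : List (List Frac) :=
  (List.finRange n).map fun s => (List.finRange n).map fun t => D s t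

variable {D : Fin n → Fin n → Frac}

theorem forall_mem_matrix {P : Frac → Prop} (hD : ∀ s t, P (D s t)) :
    ∀ r ∈ matrix D, ∀ p ∈ r, P p := by
  intro r hr p hp
  obtain ⟨s, -, rfl⟩ := List.mem_map.1 hr
  obtain ⟨t, -, rfl⟩ := List.mem_map.1 hp
  exact hD s t

theorem val_nearest_le_iff (hD : ∀ s t, Proper (D s t)) {p : Frac} (hp : Proper p) (s : Fin n)
    (η : Fin n → Degree) {v : ℝ} :
    val (nearest p ((List.finRange n).map fun t => D s t) (vecOf η)) ≤ v ↔
      1 ≤ v ∨ ∃ t, val p ≤ (η t).val ∧ val (D s t) ≤ v := by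
  rw [nearest, vecOf, List.zip_map', List.map_map, val_minL_le_iff]
  · simp only [List.mem_map, List.mem_finRange, true_and, Function.comp_apply,
      exists_exists_eq_and]
    constructor
    · rintro (h | ⟨t, ht⟩)
      · exact Or.inl h
      · have hf := fle_iff hp (proper_fracOf (η t))
        cases hpt : fle p (fracOf (η t))
        · rw [hpt, cond_false, val_one] at ht
          exact Or.inl ht
        · rw [hpt, cond_true] at ht
          exact Or.inr ⟨t, hf.1 hpt, ht⟩
    · rintro (h | ⟨t, h1, h2⟩)
      · exact Or.inl h
      · refine Or.inr ⟨t, ?_⟩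
        rw [(fle_iff hp (proper_fracOf (η t))).2 h1]
        exact h2
  · intro q hq
    obtain ⟨t, -, rfl⟩ := List.mem_map.1 hq
    dsimp only [Function.comp_apply]
    cases fle p (fracOf (η t))
    · exact proper_one
    · exact hD s t

theorem val_cover_le_iff (hD : ∀ s t, Proper (D s t)) (μ η : Fin n → Degree) {v : ℝ}
    (hv : 0 ≤ v) : val (cover (matrix D) (vecOf μ) (vecOf η)) ≤ v ↔
      Covers (fun s t => val (D s t)) v (fun x => (μ x).val) fun x => (η x).val := by
  have hnear : ∀ p s, Proper (nearest p ((List.finRange n).map fun t => D s t) (vecOf η)) := by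
    intro p s
    refine minL_of_forall proper_one fun q hq => ?_
    obtain ⟨x, hx, rfl⟩ := List.mem_map.1 hq
    obtain ⟨t, -, ht⟩ := List.mem_map.1
      (List.of_mem_zip (show (x.1, x.2) ∈ (vecOf η).zip _ from hx)).2
    cases fle p x.1
    · exact proper_one
    · rw [cond_true, ← ht]
      exact hD s t
  have hzip : ((vecOf μ).zip (matrix D)).map (fun x => fmin x.1 (nearest x.1 x.2 (vecOf η))) =
      (List.finRange n).map fun s => fmin (fracOf (μ s))
        (nearest (fracOf (μ s)) ((List.finRange n).map fun t => D s t) (vecOf η)) := by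
    rw [vecOf.eq_1 μ, matrix, List.zip_map', List.map_map]
    rfl
  rw [cover, hzip, val_maxL_le_iff _ hv]
  · simp only [List.mem_map, List.mem_finRange, true_and, forall_exists_index,
      forall_apply_eq_imp_iff]
    refine forall_congr' fun s => ?_
    rw [val_fmin (proper_fracOf _) (hnear _ _), min_le_iff,
      val_nearest_le_iff hD (proper_fracOf _)]
    constructor
    · rintro (h | h | h)
      · exact Or.inl h
      -- The case `1 ≤ v` from `nearest` is absorbed because degrees are at most `1`.
      · exact Or.inl ((μ s).val_mem_Icc.2.trans h)
      · exact Or.inr h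
    · exact Or.imp_right Or.inr
  · intro p hp
    obtain ⟨s, -, rfl⟩ := List.mem_map.1 hp
    exact fmin_of (proper_fracOf _) (hnear _ _)

theorem proper_cover (hD : ∀ s t, Proper (D s t)) (μ : Fin n → Degree) (l : List Frac) :
    Proper (cover (matrix D) (vecOf μ) l) :=
  cover_of_forall proper_zero proper_one (forall_mem_matrix hD) (proper_vecOf μ)

theorem val_liftL_le_iff (hD : ∀ s t, Proper (D s t)) (μ η : Fin n → Degree) {v : ℝ}
    (hv : 0 ≤ v) : val (liftL (matrix D) (vecOf μ) (vecOf η)) ≤ v ↔ 1 ≤ v ∨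
      LiftRel (fun s t => val (D s t)) v (fun x => (μ x).val) fun x => (η x).val := by
  have h1 : Proper (maxL (vecOf μ)) := maxL_of_forall proper_zero (proper_vecOf μ)
  have h2 : Proper (maxL (vecOf η)) := maxL_of_forall proper_zero (proper_vecOf η)
  have h3 : (fle (maxL (vecOf μ)) (maxL (vecOf η)) && fle (maxL (vecOf η)) (maxL (vecOf μ))) = true ↔
      (⨆ s, (μ s).val) = ⨆ s, (η s).val := by
    rw [Bool.and_eq_true, fle_iff h1 h2, fle_iff h2 h1, val_maxL_vecOf, val_maxL_vecOf,
      le_antisymm_iff]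
  unfold liftL LiftRel
  cases h : fle (maxL (vecOf μ)) (maxL (vecOf η)) && fle (maxL (vecOf η)) (maxL (vecOf μ))
  · rw [cond_false, val_one]
    exact ⟨Or.inl, fun h4 => h4.resolve_right fun h5 => Bool.false_ne_true (h ▸ h3.2 h5.1)⟩
  · rw [cond_true, val_fmax (proper_cover hD _ _) (proper_cover hD _ _), max_le_iff,
      val_cover_le_iff hD _ _ hv, val_cover_le_iff hD _ _ hv]
    refine ⟨fun h4 => Or.inr ⟨h3.1 h, h4⟩, ?_⟩
    rintro (h4 | h4)
    · exact ⟨covers_of_one_le (fun s => (μ s).val_mem_Icc) h4,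
        covers_of_one_le (fun s => (η s).val_mem_Icc) h4⟩
    · exact h4.2

theorem val_distL_le_iff (hD : ∀ s t, Proper (D s t)) (μ : Fin n → Degree)
    (Z : List (Fin n → Degree)) {v : ℝ} (hv : 0 ≤ v) :
    val (distL (matrix D) (vecOf μ) (Z.map vecOf)) ≤ v ↔ 1 ≤ v ∨ ∃ η ∈ Z,
      LiftRel (fun s t => val (D s t)) v (fun x => (μ x).val) fun x => (η x).val := by
  rw [distL, val_minL_le_iff]
  · simp only [List.map_map, List.mem_map, Function.comp_apply, exists_exists_and_eq_and,
      val_liftL_le_iff hD _ _ hv]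
    constructor
    · rintro (h | ⟨η, hη, h | h⟩)
      · exact Or.inl h
      · exact Or.inl h
      · exact Or.inr ⟨η, hη, h⟩
    · rintro (h | ⟨η, hη, h⟩)
      · exact Or.inl h
      · exact Or.inr ⟨η, hη, Or.inr h⟩
  · intro p hp
    rw [List.map_map] at hp
    obtain ⟨η, hη, rfl⟩ := List.mem_map.1 hp
    dsimp only [Function.comp_apply, liftL]
    cases fle (maxL (vecOf μ)) (maxL (vecOf η)) && fle (maxL (vecOf η)) (maxL (vecOf μ))
    · exact proper_one
    · exact fmax_of (proper_cover hD _ _) (proper_cover hD _ _)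

theorem proper_distL (hD : ∀ s t, Proper (D s t)) (μ : Fin n → Degree)
    (Z : List (Fin n → Degree)) : Proper (distL (matrix D) (vecOf μ) (Z.map vecOf)) :=
  distL_of_forall proper_zero proper_one (forall_mem_matrix hD) (proper_vecOf μ) fun η hη => by
    obtain ⟨w, -, rfl⟩ := List.mem_map.1 hη
    exact proper_vecOf w

theorem forall_mem_map_distL (hD : ∀ s t, Proper (D s t)) (Y Z : List (Fin n → Degree)) :
    ∀ p ∈ (Y.map vecOf).map (fun μ => distL (matrix D) μ (Z.map vecOf)), Proper p := by
  intro p hp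
  rw [List.map_map] at hp
  obtain ⟨μ, -, rfl⟩ := List.mem_map.1 hp
  exact proper_distL hD μ Z

theorem proper_hausL (hD : ∀ s t, Proper (D s t)) (Y Z : List (Fin n → Degree)) :
    Proper (hausL (matrix D) (Y.map vecOf) (Z.map vecOf)) :=
  fmax_of (maxL_of_forall proper_zero (forall_mem_map_distL hD Y Z))
    (maxL_of_forall proper_zero (forall_mem_map_distL hD Z Y))

/-- The fuzzy sets described by a list. -/
def fuzzySets (Y : List (Fin n → Degree)) : Set (Fin n → ℝ) :=
  {μ | ∃ w ∈ Y, μ = fun x => (w x).val}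

theorem val_hausL_le_iff (hD : ∀ s t, Proper (D s t)) (Y Z : List (Fin n → Degree)) {v : ℝ}
    (hv : 0 ≤ v) : val (hausL (matrix D) (Y.map vecOf) (Z.map vecOf)) ≤ v ↔
      1 ≤ v ∨ HausRel (fun s t => val (D s t)) v (fuzzySets Y) (fuzzySets Z) := by
  have key : ∀ Y Z : List (Fin n → Degree),
      val (maxL ((Y.map vecOf).map fun μ => distL (matrix D) μ (Z.map vecOf))) ≤ v ↔
        ∀ μ ∈ fuzzySets Y, 1 ≤ v ∨ ∃ η ∈ fuzzySets Z, LiftRel (fun s t => val (D s t)) v μ η := by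
    intro Y Z
    rw [val_maxL_le_iff (forall_mem_map_distL hD Y Z) hv]
    simp only [List.map_map, List.mem_map, Function.comp_apply, forall_exists_index, and_imp,
      forall_apply_eq_imp_iff₂, val_distL_le_iff hD _ _ hv, fuzzySets, Set.mem_ofPred_eq]
    constructor
    · rintro h _ w hw rfl
      refine (h w hw).imp_right ?_
      rintro ⟨η, hη, h⟩
      exact ⟨_, ⟨η, hη, rfl⟩, h⟩
    · intro h w hw
      refine (h _ w hw rfl).imp_right ?_
      rintro ⟨_, ⟨η, hη, rfl⟩, h⟩
      exact ⟨η, hη, h⟩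
  rw [hausL, val_fmax (maxL_of_forall proper_zero (forall_mem_map_distL hD Y Z))
    (maxL_of_forall proper_zero (forall_mem_map_distL hD Z Y)), max_le_iff, key, key]
  by_cases h : 1 ≤ v <;> simp [h, HausRel]

variable {a b : ℕ}

theorem val_rowDistL_le_iff {M : RationalFTS} {D : Fin M.n → Fin M.n → Frac}
    (hD : ∀ s t, Proper (D s t)) (s t : Fin M.n) {v : ℝ} (hv : 0 ≤ v) :
    val (rowDistL (matrix D) ((List.finRange M.k).map fun a => (M.trans s a).map vecOf)
      ((List.finRange M.k).map fun a => (M.trans t a).map vecOf)) ≤ v ↔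
      1 ≤ v ∨ ∀ a, HausRel (fun s t => val (D s t)) v (M.toFTS.δ s a) (M.toFTS.δ t a) := by
  rw [rowDistL, List.zip_map', List.map_map, val_maxL_le_iff _ hv]
  · simp only [List.mem_map, List.mem_finRange, true_and, Function.comp_apply,
      forall_exists_index, forall_apply_eq_imp_iff, val_hausL_le_iff hD _ _ hv, forall_or_left]
    rfl
  · intro p hp
    obtain ⟨a, -, rfl⟩ := List.mem_map.1 hp
    exact proper_hausL hD _ _

end

theorem finite_delta (M : RationalFTS) (s : Fin M.n) (a : Fin M.k) : (M.toFTS.δ s a).Finite := by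
  refine ((M.trans s a).finite_toSet.image fun w x => (w x).val).subset ?_
  rintro _ ⟨w, hw, rfl⟩
  exact ⟨w, hw, rfl⟩

/-- After division by `γ`, both the computed entry and `Δ` are at most `v` under the same condition,
`1 ≤ v` or `HausRel` for all labels, and so they agree. -/
theorem exists_stepL_eq {M : RationalFTS} {a b : ℕ} (ha : 0 < a) (hab : a ≤ b)
    {D : Fin M.n → Fin M.n → Frac} (hD : ∀ s t, Proper (D s t))
    (hd : IsPseudoUltrametric fun s t => val (D s t)) :
    ∃ D' : Fin M.n → Fin M.n → Frac, (∀ s t, Proper (D' s t)) ∧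
      (fun s t => val (D' s t)) = functional M.toFTS (a / b : ℝ) (fun s t => val (D s t)) ∧
      stepL a b (tableOf M) (matrix D) = matrix D' := by
  have hb := ha.trans_le hab
  have hγ : (0 : ℝ) < a / b := div_pos (by exact_mod_cast ha) (by exact_mod_cast hb)
  refine ⟨fun s t => scale a b (rowDistL (matrix D)
    ((List.finRange M.k).map fun a => (M.trans s a).map vecOf)
    ((List.finRange M.k).map fun a => (M.trans t a).map vecOf)), fun s t => ?_, ?_, ?_⟩
  · refine Proper.scale hb hab (maxL_of_forall proper_zero fun p hp => ?_)
    rw [List.zip_map', List.map_map] at hp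
    obtain ⟨a, -, rfl⟩ := List.mem_map.1 hp
    exact proper_hausL hD _ _
  · funext s t
    rw [val_scale, ← mul_div_cancel₀ (functional M.toFTS _ _ s t) hγ.ne']
    congr 1
    refine eq_of_forall_nonneg_iff (val_nonneg _)
      (div_nonneg (functional_nonneg hd hγ s t) hγ.le) fun v hv => ?_
    rw [val_rowDistL_le_iff hD s t hv, div_le_iff₀' hγ, functional_le_iff (finite_delta M) hd hγ hv]
  · rw [stepL, tableOf, List.map_map]
    refine List.map_congr_left fun s _ => ?_
    rw [Function.comp_apply, List.map_map]
    rfl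

theorem exists_iterate_stepL_eq (M : RationalFTS) {a b : ℕ} (ha : 0 < a) (hab : a < b) (i : ℕ) :
    ∃ D : Fin M.n → Fin M.n → Frac, (∀ s t, Proper (D s t)) ∧
      (fun s t => val (D s t)) = iter M.toFTS (a / b : ℝ) i ∧
      (stepL a b (tableOf M))^[i] (zeroL (tableOf M)) = matrix D := by
  have hb : (0 : ℝ) < b := by exact_mod_cast ha.trans hab
  have hγ : (0 : ℝ) < a / b := div_pos (by exact_mod_cast ha) hb
  have hγ1 : (a / b : ℝ) < 1 := (div_lt_one hb).2 (by exact_mod_cast hab)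
  induction i with
  | zero =>
    refine ⟨fun _ _ => (0, 1), fun _ _ => proper_zero, ?_, ?_⟩
    · simp only [val_zero]
      rfl
    · rw [Function.iterate_zero_apply, zeroL, tableOf, List.map_map]
      refine List.map_congr_left fun s _ => ?_
      rw [Function.comp_apply, List.map_map]
      rfl
  | succ i ih =>
    obtain ⟨D, h1, h2, h3⟩ := ih
    obtain ⟨D', h4, h5, h6⟩ := exists_stepL_eq ha hab.le h1
      (h2 ▸ isPseudoUltrametric_iter (finite_delta M) hγ hγ1 i)
    refine ⟨D', h4, ?_, ?_⟩
    · rw [h5, h2, iter_succ]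
    · rw [Function.iterate_succ_apply', h3, h6]

theorem exists_behaviouralDistance_eq (M : RationalFTS) {a b : ℕ} (ha : 0 < a) (hab : a < b) :
    ∃ num den : Fin M.n → Fin M.n → ℕ, (∀ s t, 0 < den s t) ∧
      IsBehaviouralDistance M.toFTS (a / b : ℝ) (fun s t => (num s t : ℝ) / (den s t : ℝ)) ∧
      (encodeMatrix num den).map symPair = outputOf a b (unary M.n, numsOf M) := by
  have hb : (0 : ℝ) < b := by exact_mod_cast ha.trans hab
  have hγ : (0 : ℝ) < a / b := div_pos (by exact_mod_cast ha) hb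
  have hγ1 : (a / b : ℝ) < 1 := (div_lt_one hb).2 (by exact_mod_cast hab)
  obtain ⟨D, h1, h2, h3⟩ := exists_iterate_stepL_eq M ha hab (M.n * M.n)
  refine ⟨fun s t => (D s t).1, fun s t => (D s t).2, fun s t => (h1 s t).1, ?_, ?_⟩
  · have h := isBehaviouralDistance_iter (finite_delta M) hγ hγ1
    rw [Fintype.card_fin, ← h2] at h
    exact h
  · have hlen : (tableOf M).length = M.n := by simp [tableOf]
    rw [outputOf, writeNats_eq, parseTable_eq, iterL_eq, hlen, h3, encodeMatrix, matrix]
    simp only [List.flatMap_map]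

end StackProgram

/-! ### Assembly of the main theorem. -/

theorem mainTheorem2 (γ : ℚ) (hγ₀ : 0 < γ) (hγ₁ : γ < 1) :
    ∃ (T : Turing.TM2ComputableAux (Option Bool) (Option Bool)) (p : Polynomial ℕ),
      ∀ M : FuzzyTransition.RationalFTS, ∃ num den : Fin M.n → Fin M.n → ℕ,
        (∀ s t, 0 < den s t) ∧
        FuzzyTransition.IsBehaviouralDistance M.toFTS (γ : ℝ)
          (fun s t => (num s t : ℝ) / (den s t : ℝ)) ∧
        Nonempty (Turing.TM2OutputsInTime T.tm
          (M.encode.map T.inputAlphabet.symm)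
          (some ((FuzzyTransition.encodeMatrix num den).map T.outputAlphabet.symm))
          (p.eval M.size)) := by
  obtain ⟨a, ha⟩ := Int.eq_ofNat_of_zero_le (Rat.num_pos.2 hγ₀).le
  have hγ' : γ = (a / γ.den : ℚ) := by
    conv_lhs => rw [← Rat.num_div_den γ, ha, Int.cast_natCast]
  have hγ : (γ : ℝ) = (a / γ.den : ℝ) := by
    conv_lhs => rw [hγ']
    push_cast
    rfl
  have ha0 : 0 < a := by
    have := Rat.num_pos.2 hγ₀
    omega
  have hab : a < γ.den := by
    rw [hγ', div_lt_one (by exact_mod_cast γ.den_pos)] at hγ₁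
    exact_mod_cast hγ₁
  obtain ⟨c, p, hc⟩ := StackProgram.exists_program a γ.den
  obtain ⟨q, hq⟩ := StackProgram.polyBd_inputSize_numsOf
  -- The program depends on `γ` only through its numerator and denominator; the summand `1` is the
  -- halting step.
  refine ⟨⟨StackProgram.machine c, Equiv.refl _, Equiv.refl _⟩, p.comp q + 1, fun M => ?_⟩
  obtain ⟨num, den, h1, h2, h3⟩ := StackProgram.exists_behaviouralDistance_eq M ha0 hab
  refine ⟨num, den, h1, hγ ▸ h2, ?_⟩
  have h4 := hc (StackProgram.numsOf M) _ h3
  have h5 := StackProgram.machine_outputs (h4.mono (StackProgram.eval_mono p (hq M)))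
  rw [Polynomial.eval_add, Polynomial.eval_comp, Polynomial.eval_one]
  exact (congrArg₂ (fun w w' : List StackProgram.Sym => Nonempty (Turing.TM2OutputsInTime
    (StackProgram.machine c) w (some w') _)) (List.map_id _) (List.map_id _)).mpr h5
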